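/- All orderings are countable (possibly empty) and are counted up to isomorphism. A structure is homogeneous if every isomorphism between finitely generated substructures extends to an automorphism. In a linear ordering, the successors of a point $x$ are the points reached from $x$ by passing one or more times to an immediate successor; predecessors are defined dually. Let $S_i(x)$ say that $x$ has exactly $i$ successors, $P_j(x)$ that $x$ has exactly $j$ predecessors, and $\mathrm{Adj}_l(x,y)$ that $x\ne y$ and exactly $l$ points lie strictly between $x$ and $y$. For $n,m\in\mathbb N$, a linear ordering is $C_{n,m}$-homogeneous if its expansion by $\{S_i\}_{i<n}$, $\{P_j\}_{j<m}$, $\{\mathrm{Adj}_l\}_{l<n+m}$ is homogeneous. It is sp-homogeneous if its expansion by the functions $s,p$ is homogeneous, where $s(x)$ (resp. $p(x)$) is the immediate successor (resp. predecessor) of $x$ if it exists and $x$ otherwise. The block of $x$ is the set of points $y$ such that only finitely many points lie between $x$ and $y$. Let $I_{n,m}$ be the number of $C_{n,m}$-homogeneous linear orderings, $I(k)$ the number of sp-homogeneous linear orderings all of whose blocks have at most $k$ elements, and $L(k)$ the number of homogeneous linear orderings with $k$ colors (linear orderings in which each point carries exactly one of $k$ given colors, the colors being unary predicates of the language; not all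 colors need to be used). Proposition. All these numbers are finite. There is an absolute constant $C$ such that for all $n,m\ge 0$, with $k=n+m+1$, $$I_{n,m}\le C\,k!\,(2.123)^k ,$$ and $I_{n,m}/L(k)\to 0$ as $k=n+m+1\to\infty$, uniformly in the choice of $n,m$. Likewise $I(k)=O(k!\,(2.123)^k)$ and $\lim_{k\to\infty} I(k)/L(k)=0$. -/

import Mathlib

open Filter Topology
open scoped Nat

namespace LinHom

open FirstOrder

noncomputable section

section Predicates

variable {X : Type} [LinearOrder X]

/-- The iterated immediate successors of `x`: the points obtained from `x` by passing to
an immediate successor one or more times. -/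
def succs (x : X) : Set X := {y | Relation.TransGen (· ⋖ ·) x y}

/-- The iterated immediate predecessors of `x`. -/
def preds (x : X) : Set X := {y | Relation.TransGen (· ⋖ ·) y x}

/-- `S_i`: the point `x` has exactly `i` successors. -/
def HasSuccs (i : ℕ) (x : X) : Prop := (succs x).encard = i

/-- `P_j`: the point `x` has exactly `j` predecessors. -/
def HasPreds (j : ℕ) (x : X) : Prop := (preds x).encard = j

/-- `Adj_l`: there are exactly `l` points strictly between the distinct points `x` and `y`. -/
def Adj (l : ℕ) (x y : X) : Prop := x ≠ y ∧ (Set.Ioo (min x y) (max x y)).encard = l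

/-- The block of `x`: all points that are finitely far from `x`. -/
def block (x : X) : Set X := {y | (Set.uIcc x y).Finite}

open Classical in
/-- The immediate successor of `x` if there is one, and `x` otherwise. -/
def succFn (x : X) : X := if h : ∃ y, x ⋖ y then h.choose else x

open Classical in
/-- The immediate predecessor of `x` if there is one, and `x` otherwise. -/
def predFn (x : X) : X := if h : ∃ y, y ⋖ x then h.choose else x

end Predicates

/-- The relation symbols `<`, `S_i` (`i < n`), `P_j` (`j < m`), `Adj_l` (`l < n + m`). -/
inductive CRel (n m : ℕ) : ℕ → Type
  | lt : CRel n m 2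
  | S (i : Fin n) : CRel n m 1
  | P (j : Fin m) : CRel n m 1
  | Adj (l : Fin (n + m)) : CRel n m 2

/-- The relational language of `C_{n,m}`. -/
def CLang (n m : ℕ) : Language := ⟨fun _ => Empty, CRel n m⟩

/-- The expansion by definitions of a linear ordering to the language of `C_{n,m}`. -/
abbrev CStructure (n m : ℕ) (X : Type) [LinearOrder X] : (CLang n m).Structure X where
  funMap := fun f _ => Empty.elim f
  RelMap := fun r => match r with
    | CRel.lt => fun v => v 0 < v 1
    | CRel.S i => fun v => HasSuccs i (v 0)
    | CRel.P j => fun v => HasPreds j (v 0)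
    | CRel.Adj l => fun v => Adj l (v 0) (v 1)

/-- The function symbols `s` and `p`. -/
inductive SpFunc : ℕ → Type
  | s : SpFunc 1
  | p : SpFunc 1

/-- The relation symbol `<`. -/
inductive LtRel : ℕ → Type
  | lt : LtRel 2

/-- The language with `<` and unary functions `s`, `p`. -/
def SpLang : Language := ⟨SpFunc, LtRel⟩

/-- A linear ordering with its successor and predecessor functions. -/
abbrev SpStructure (X : Type) [LinearOrder X] : SpLang.Structure X where
  funMap := fun f => match f with
    | SpFunc.s => fun v => succFn (v 0)
    | SpFunc.p => fun v => predFn (v 0)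
  RelMap := fun r => match r with
    | LtRel.lt => fun v => v 0 < v 1

/-- `X` is `C_{n,m}`-homogeneous: in the language of `C_{n,m}`, every isomorphism between finitely
generated (here: finite) substructures extends to an automorphism. -/
def CHomogeneous (n m : ℕ) (X : Type) [LinearOrder X] : Prop :=
  @Language.IsUltrahomogeneous (CLang n m) X (CStructure n m X)

/-- `X` is sp-homogeneous: `(X, <, s, p)` is homogeneous. -/
def SpHomogeneous (X : Type) [LinearOrder X] : Prop :=
  @Language.IsUltrahomogeneous SpLang X (SpStructure X)

/-- Isomorphism of linear orderings. -/
instance linOrdSetoid : Setoid LinOrd.{0} where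
  r X Y := Nonempty (X ≃o Y)
  iseqv := ⟨fun _ => ⟨OrderIso.refl _⟩, fun ⟨e⟩ => ⟨e.symm⟩, fun ⟨e⟩ ⟨f⟩ => ⟨e.trans f⟩⟩

/-- The order types of the countable `C_{n,m}`-homogeneous linear orderings. -/
def cHomTypes (n m : ℕ) : Set (Quotient linOrdSetoid) :=
  Quotient.mk linOrdSetoid '' {X | Countable X ∧ CHomogeneous n m X}

/-- The order types of the countable sp-homogeneous linear orderings all of whose blocks have
at most `k` elements. -/
def spHomTypes (k : ℕ) : Set (Quotient linOrdSetoid) :=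
  Quotient.mk linOrdSetoid '' {X | Countable X ∧ SpHomogeneous X ∧ ∀ x : X, (block x).encard ≤ k}

/-- A countable linear ordering each of whose points carries one of `k` colors. -/
structure ColoredLinOrd (k : ℕ) where
  carrier : Type
  [order : LinearOrder carrier]
  [countable : Countable carrier]
  color : carrier → Fin k

attribute [instance] ColoredLinOrd.order

/-- The relation symbol `<` and a unary predicate for each of the `k` colors. -/
inductive ColorRel (k : ℕ) : ℕ → Type
  | lt : ColorRel k 2
  | color (i : Fin k) : ColorRel k 1

/-- The language of `k`-colored linear orderings. -/
def ColorLang (k : ℕ) : Language := ⟨fun _ => Empty, ColorRel k⟩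

instance colorStructure {k : ℕ} (X : ColoredLinOrd k) : (ColorLang k).Structure X.carrier where
  funMap := fun f _ => Empty.elim f
  RelMap := fun r => match r with
    | ColorRel.lt => fun v => v 0 < v 1
    | ColorRel.color i => fun v => X.color (v 0) = i

/-- Isomorphism of `k`-colored linear orderings: an order isomorphism that preserves colors. -/
instance coloredSetoid (k : ℕ) : Setoid (ColoredLinOrd k) where
  r X Y := ∃ e : X.carrier ≃o Y.carrier, ∀ x, Y.color (e x) = X.color x
  iseqv := ⟨fun _ => ⟨OrderIso.refl _, fun _ => rfl⟩,
    fun ⟨e, he⟩ => ⟨e.symm, fun x => by rw [← he, e.apply_symm_apply]⟩,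
    fun ⟨e, he⟩ ⟨f, hf⟩ => ⟨e.trans f, fun x => (hf (e x)).trans (he x)⟩⟩

/-- The isomorphism types of the countable homogeneous linear orderings with `k` colors. -/
def colorHomTypes (k : ℕ) : Set (Quotient (coloredSetoid k)) :=
  Quotient.mk (coloredSetoid k) '' {X | (ColorLang k).IsUltrahomogeneous X.carrier}

/-- The number of `C_{n,m}`-homogeneous linear orderings. -/
def numC (n m : ℕ) : ℕ := (cHomTypes n m).ncard

/-- The number of sp-homogeneous linear orderings with blocks of size at most `k`. -/
def numSp (k : ℕ) : ℕ := (spHomTypes k).ncard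

/-- `L(k)`: the number of homogeneous linear orderings with `k` colors. -/
def numColored (k : ℕ) : ℕ := (colorHomTypes k).ncard

end

end LinHom

/-!
By back-and-forth, a countable homogeneous colored linear ordering is determined by its pattern:
the set of colors in use together with the pairs of colors `c`, `d` such that some point of color
`c` lies before some point of color `d`, a relation which is transitive and total between distinct
colors. Every such relation is realized, so `L(k)` counts these arrangements on the subsets of `k`
colors.

A `C_{n,m}`-homogeneous ordering is sp-homogeneous and its blocks have at most `n + m + 1` points:
in a larger block some point could be mapped to its immediate successor, hence the block would be
infinite and an automorphism could change the number of points between two of them. Contracting the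
finite blocks of an sp-homogeneous ordering and coloring each by its size gives a homogeneous
colored ordering which is dense, so its pattern is interpolative: between any two related colors
there is a third, possibly equal to one of them.

Both kinds of arrangements are counted by peeling off the class of the top elements. Interpolation
forbids two consecutive classes consisting of a single non-repeated color, and this lowers the
growth rate of the count, relative to `k!`, from at least `11/5` to at most `2`.
-/

namespace LinHom

open FirstOrder

section BackAndForth

variable {X Y κ : Type*} [LinearOrder X] [LinearOrder Y] {cX : X → κ} {cY : Y → κ}

/-- `F` is (the graph of) a finite partial isomorphism of colored linear orderings. -/
def IsPartialIso (cX : X → κ) (cY : Y → κ) (F : Finset (X × Y)) : Prop :=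
  (∀ p ∈ F, cY p.2 = cX p.1) ∧ ∀ p ∈ F, ∀ q ∈ F, p.1 < q.1 ↔ p.2 < q.2

/-- The color `c` occurs somewhere before the color `d`. -/
def ColorBefore (cX : X → κ) (c d : κ) : Prop := ∃ x y, x < y ∧ cX x = c ∧ cX y = d

/-- The complete invariant of a countable homogeneous colored linear ordering: the colors in use,
and the pairs of colors that occur in this order. -/
def colorPattern (cX : X → κ) : Set κ × Set (κ × κ) :=
  (Set.range cX, {p | ColorBefore cX p.1 p.2})

/-- Every interval and every half-line with endpoints in the ordering contains each color that
`ColorBefore` allows there. This is the first-order counterpart of homogeneity. -/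
structure IsSaturated (cX : X → κ) : Prop where
  between : ∀ x y c, x < y → ColorBefore cX (cX x) c → ColorBefore cX c (cX y) →
    ∃ z, x < z ∧ z < y ∧ cX z = c
  above : ∀ x c, ColorBefore cX (cX x) c → ∃ z, x < z ∧ cX z = c
  below : ∀ x c, ColorBefore cX c (cX x) → ∃ z, z < x ∧ cX z = c

theorem ColorBefore.map {f : X → Y} (hf : StrictMono f) (hc : ∀ x, cY (f x) = cX x) {c d : κ} :
    ColorBefore cX c d → ColorBefore cY c d := by
  rintro ⟨x, y, hxy, rfl, rfl⟩
  exact ⟨f x, f y, hf hxy, hc x, hc y⟩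

theorem ColorBefore.of_colorPattern_le (h : colorPattern cX ≤ colorPattern cY) {c d : κ}
    (hcd : ColorBefore cX c d) : ColorBefore cY c d :=
  h.2 (show (c, d) ∈ {p | ColorBefore cX p.1 p.2} from hcd)

theorem IsPartialIso.empty : IsPartialIso cX cY ∅ := by simp [IsPartialIso]

theorem IsPartialIso.eq_iff {F : Finset (X × Y)} (hF : IsPartialIso cX cY F) {p q : X × Y}
    (hp : p ∈ F) (hq : q ∈ F) : p.1 = q.1 ↔ p.2 = q.2 := by
  simp only [le_antisymm_iff, ← not_lt, hF.2 p hp q hq, hF.2 q hq p hp]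

theorem IsPartialIso.swap {F : Finset (X × Y)} (hF : IsPartialIso cX cY F) :
    IsPartialIso cY cX (F.map (Equiv.prodComm X Y).toEmbedding) := by
  simp only [IsPartialIso, Finset.forall_mem_map]
  exact ⟨fun p hp => (hF.1 p hp).symm, fun p hp q hq => (hF.2 p hp q hq).symm⟩

theorem IsSaturated.exists_between_finsets (hY : IsSaturated cY) {A B : Finset Y} {c : κ}
    (hc : c ∈ Set.range cY) (hAB : ∀ a ∈ A, ∀ b ∈ B, a < b)
    (hA : ∀ a ∈ A, ColorBefore cY (cY a) c) (hB : ∀ b ∈ B, ColorBefore cY c (cY b)) :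
    ∃ y, cY y = c ∧ (∀ a ∈ A, a < y) ∧ ∀ b ∈ B, y < b := by
  rcases A.eq_empty_or_nonempty with rfl | hA₀ <;> rcases B.eq_empty_or_nonempty with rfl | hB₀
  · obtain ⟨y, hy⟩ := hc
    exact ⟨y, hy, by simp, by simp⟩
  · obtain ⟨y, hlt, hy⟩ := hY.below _ _ (hB _ (B.min'_mem hB₀))
    exact ⟨y, hy, by simp, fun b hb => hlt.trans_le (B.min'_le b hb)⟩
  · obtain ⟨y, hlt, hy⟩ := hY.above _ _ (hA _ (A.max'_mem hA₀))
    exact ⟨y, hy, fun a ha => (A.le_max' a ha).trans_lt hlt, by simp⟩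
  · obtain ⟨y, hay, hyb, hy⟩ := hY.between _ _ c (hAB _ (A.max'_mem hA₀) _ (B.min'_mem hB₀))
      (hA _ (A.max'_mem hA₀)) (hB _ (B.min'_mem hB₀))
    exact ⟨y, hy, fun a ha => (A.le_max' a ha).trans_lt hay,
      fun b hb => hyb.trans_le (B.min'_le b hb)⟩

theorem IsSaturated.exists_image (hY : IsSaturated cY) (h : colorPattern cX ≤ colorPattern cY)
    {F : Finset (X × Y)} (hF : IsPartialIso cX cY F) (x : X) :
    ∃ y, cY y = cX x ∧ (∀ p ∈ F, p.1 < x → p.2 < y) ∧ ∀ p ∈ F, x < p.1 → y < p.2 := by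
  classical
  obtain ⟨y, hy, hA, hB⟩ := hY.exists_between_finsets
    (A := {p ∈ F | p.1 < x}.image Prod.snd) (B := {p ∈ F | x < p.1}.image Prod.snd)
    (h.1 ⟨x, rfl⟩)
    (by
      simp only [Finset.forall_mem_image, Finset.mem_filter, and_imp]
      exact fun p hp hpx q hq hxq => (hF.2 p hp q hq).1 (hpx.trans hxq))
    (by
      simp only [Finset.forall_mem_image, Finset.mem_filter, and_imp]
      exact fun p hp hpx => .of_colorPattern_le h ⟨p.1, x, hpx, (hF.1 p hp).symm, rfl⟩)
    (by
      simp only [Finset.forall_mem_image, Finset.mem_filter, and_imp]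
      exact fun p hp hxp => .of_colorPattern_le h ⟨x, p.1, hxp, rfl, (hF.1 p hp).symm⟩)
  simp only [Finset.forall_mem_image, Finset.mem_filter, and_imp] at hA hB
  exact ⟨y, hy, fun p hp => hA hp, fun p hp => hB hp⟩

theorem IsSaturated.exists_extension (hY : IsSaturated cY) (h : colorPattern cX ≤ colorPattern cY)
    {F : Finset (X × Y)} (hF : IsPartialIso cX cY F) (x : X) :
    ∃ G, IsPartialIso cX cY G ∧ F ⊆ G ∧ ∃ y, (x, y) ∈ G := by
  classical
  by_cases hx : ∃ y, (x, y) ∈ F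
  · exact ⟨F, hF, subset_rfl, hx⟩
  obtain ⟨y, hc, hlo, hhi⟩ := hY.exists_image h hF x
  have hne : ∀ p ∈ F, p.1 ≠ x := fun p hp e => hx ⟨p.2, e ▸ hp⟩
  have hlt : ∀ p ∈ F, p.1 < x ↔ p.2 < y := fun p hp => ⟨hlo p hp, fun hpy =>
    (hne p hp).lt_or_gt.resolve_right fun hxp => hpy.asymm (hhi p hp hxp)⟩
  have hgt : ∀ p ∈ F, x < p.1 ↔ y < p.2 := fun p hp => ⟨hhi p hp, fun hyp =>
    (hne p hp).lt_or_gt.resolve_left fun hpx => hyp.asymm (hlo p hp hpx)⟩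
  refine ⟨insert (x, y) F, ⟨?_, ?_⟩, Finset.subset_insert _ _, y, Finset.mem_insert_self _ _⟩
  · simpa only [Finset.forall_mem_insert] using ⟨hc, hF.1⟩
  · simp only [Finset.forall_mem_insert, lt_self_iff_false, true_and]
    exact ⟨hgt, fun p hp => ⟨hlt p hp, hF.2 p hp⟩⟩

theorem IsPartialIso.exists_orderIso_of_directedOn {I : Set (Finset (X × Y))}
    (hI : ∀ F ∈ I, IsPartialIso cX cY F) (hdir : DirectedOn (· ⊆ ·) I)
    (hleft : ∀ x, ∃ y, ∃ F ∈ I, (x, y) ∈ F) (hright : ∀ y, ∃ x, ∃ F ∈ I, (x, y) ∈ F) :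
    ∃ e : X ≃o Y, (∀ x, cY (e x) = cX x) ∧ ∀ F ∈ I, ∀ p ∈ F, e p.1 = p.2 := by
  choose f hf using hleft
  choose g hg using hright
  have hcommon : ∀ p q : X × Y, (∃ F ∈ I, p ∈ F) → (∃ F ∈ I, q ∈ F) → ∃ F ∈ I, p ∈ F ∧ q ∈ F := by
    rintro p q ⟨F, hF, hp⟩ ⟨G, hG, hq⟩
    obtain ⟨H, hH, hFH, hGH⟩ := hdir F hF G hG
    exact ⟨H, hH, hFH hp, hGH hq⟩
  have hmono : StrictMono f := fun x x' hlt => by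
    obtain ⟨F, hF, hx, hx'⟩ := hcommon _ _ (hf x) (hf x')
    exact ((hI F hF).2 _ hx _ hx').1 hlt
  have hgraph : ∀ F ∈ I, ∀ p ∈ F, f p.1 = p.2 := fun F hF p hp => by
    obtain ⟨G, hG, hfp, hp'⟩ := hcommon _ _ (hf p.1) ⟨F, hF, hp⟩
    exact ((hI G hG).eq_iff hfp hp').1 rfl
  have hsurj : Function.Surjective f := fun y => by
    obtain ⟨F, hF, hp⟩ := hg y
    exact ⟨g y, hgraph F hF _ hp⟩
  refine ⟨hmono.orderIsoOfSurjective f hsurj, fun x => ?_, hgraph⟩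
  obtain ⟨F, hF, hx⟩ := hf x
  exact (hI F hF).1 _ hx

/-- The finite partial isomorphisms, ordered by extension. -/
abbrev PartialIso (cX : X → κ) (cY : Y → κ) : Type _ :=
  {F : Finset (X × Y) // IsPartialIso cX cY F}

/-- The cofinal set of the partial isomorphisms that are defined at `x`. -/
def PartialIso.definedAt (hY : IsSaturated cY) (h : colorPattern cX ≤ colorPattern cY) (x : X) :
    Order.Cofinal (PartialIso cX cY) where
  carrier := {F | ∃ y, (x, y) ∈ F.1}
  isCofinal F :=
    let ⟨G, hG, hFG, hx⟩ := hY.exists_extension h F.2 x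
    ⟨⟨G, hG⟩, hx, hFG⟩

/-- The cofinal set of the partial isomorphisms that have `y` in their image. -/
def PartialIso.hitting (hX : IsSaturated cX) (h : colorPattern cY ≤ colorPattern cX) (y : Y) :
    Order.Cofinal (PartialIso cX cY) where
  carrier := {F | ∃ x, (x, y) ∈ F.1}
  isCofinal F := by
    obtain ⟨G, hG, hFG, x, hx⟩ := hX.exists_extension h F.2.swap y
    exact ⟨⟨_, hG.swap⟩, ⟨x, Finset.mem_map.2 ⟨_, hx, rfl⟩⟩,
      fun p hp => Finset.mem_map.2 ⟨p.swap, hFG (Finset.mem_map.2 ⟨p, hp, rfl⟩), rfl⟩⟩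

theorem IsSaturated.exists_orderIso_extending [Countable X] [Countable Y] (hX : IsSaturated cX)
    (hY : IsSaturated cY) (h : colorPattern cX = colorPattern cY) {F : Finset (X × Y)}
    (hF : IsPartialIso cX cY F) :
    ∃ e : X ≃o Y, (∀ x, cY (e x) = cX x) ∧ ∀ p ∈ F, e p.1 = p.2 := by
  have := Encodable.ofCountable X
  have := Encodable.ofCountable Y
  let D : X ⊕ Y → Order.Cofinal (PartialIso cX cY) :=
    Sum.elim (PartialIso.definedAt hY h.le) (PartialIso.hitting hX h.ge)
  let I := Order.idealOfCofinals ⟨F, hF⟩ D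
  obtain ⟨e, hcolor, hgraph⟩ := IsPartialIso.exists_orderIso_of_directedOn (cX := cX) (cY := cY)
    (I := Subtype.val '' (I : Set (PartialIso cX cY)))
    (by rintro _ ⟨G, -, rfl⟩; exact G.2)
    (by
      rintro _ ⟨G, hG, rfl⟩ _ ⟨G', hG', rfl⟩
      obtain ⟨H, hH, hGH, hGH'⟩ := I.directed G hG G' hG'
      exact ⟨H, ⟨H, hH, rfl⟩, hGH, hGH'⟩)
    (fun x =>
      let ⟨G, ⟨y, hy⟩, hG⟩ := Order.cofinal_meets_idealOfCofinals ⟨F, hF⟩ D (.inl x)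
      ⟨y, G.1, ⟨G, hG, rfl⟩, hy⟩)
    (fun y =>
      let ⟨G, ⟨x, hx⟩, hG⟩ := Order.cofinal_meets_idealOfCofinals ⟨F, hF⟩ D (.inr y)
      ⟨x, G.1, ⟨G, hG, rfl⟩, hx⟩)
  exact ⟨e, hcolor, hgraph F ⟨_, Order.mem_idealOfCofinals _ D, rfl⟩⟩

theorem IsSaturated.exists_orderIso [Countable X] [Countable Y] (hX : IsSaturated cX)
    (hY : IsSaturated cY) (h : colorPattern cX = colorPattern cY) :
    ∃ e : X ≃o Y, ∀ x, cY (e x) = cX x :=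
  let ⟨e, he, _⟩ := hX.exists_orderIso_extending hY h .empty
  ⟨e, he⟩

theorem IsSaturated.of_forall_exists_strictMono
    (h : ∀ F : Finset (X × X), IsPartialIso cX cX F →
      ∃ g : X → X, StrictMono g ∧ (∀ x, cX (g x) = cX x) ∧ ∀ p ∈ F, g p.1 = p.2) :
    IsSaturated cX := by
  classical
  have exists_move : ∀ x x', cX x = cX x' →
      ∃ g : X → X, StrictMono g ∧ (∀ x, cX (g x) = cX x) ∧ g x' = x := fun x x' hx => by
    simpa using h {(x', x)} (by simp [IsPartialIso, hx])
  have above : ∀ x c, ColorBefore cX (cX x) c → ∃ z, x < z ∧ cX z = c := by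
    rintro x c ⟨x', z', hlt, hx, rfl⟩
    obtain ⟨g, hg, hc, rfl⟩ := exists_move x x' hx.symm
    exact ⟨g z', hg hlt, hc _⟩
  have below : ∀ x c, ColorBefore cX c (cX x) → ∃ z, z < x ∧ cX z = c := by
    rintro x c ⟨z', x', hlt, rfl, hx⟩
    obtain ⟨g, hg, hc, rfl⟩ := exists_move x x' hx.symm
    exact ⟨g z', hg hlt, hc _⟩
  refine ⟨fun x y c hxy hxc hcy => ?_, above, below⟩
  -- Find `x < z < y'` with the right colors, then move `y'` to `y` while fixing `x`.
  obtain ⟨z, hxz, rfl⟩ := above x c hxc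
  obtain ⟨y', hzy', hy'⟩ := above z _ hcy
  have hxy' := hxz.trans hzy'
  obtain ⟨g, hg, hc, hgF⟩ := h {(x, x), (y', y)}
    (by simp [IsPartialIso, hy', hxy, hxy', hxy'.not_gt, hxy.not_gt])
  have hgx : g x = x := hgF (x, x) (by simp)
  have hgy' : g y' = y := hgF (y', y) (by simp)
  exact ⟨g z, by simpa only [hgx] using hg hxz, by simpa only [hgy'] using hg hzy', hc _⟩

end BackAndForth

section Counting

variable {α : Type*}

/-- Transitive relations on `U` in which any two distinct elements are comparable: these are the
relations `ColorBefore` of the homogeneous colored orderings that use exactly the colors in `U`.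
An element `a` is related to itself when its color is repeated. -/
structure IsArrangement (U : Finset α) (R : Finset (α × α)) : Prop where
  left_mem : ∀ {a b}, (a, b) ∈ R → a ∈ U
  right_mem : ∀ {a b}, (a, b) ∈ R → b ∈ U
  trans : ∀ {a b c}, (a, b) ∈ R → (b, c) ∈ R → (a, c) ∈ R
  total : ∀ {a b}, a ∈ U → b ∈ U → a ≠ b → (a, b) ∈ R ∨ (b, a) ∈ R

/-- Any two related elements have an element between them. For `ColorBefore` this says that no
point of the colored ordering is the immediate successor of another. -/
def IsInterpolative (R : Finset (α × α)) : Prop :=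
  ∀ a b, (a, b) ∈ R → ∃ c, (a, c) ∈ R ∧ (c, b) ∈ R

/-- The element `a` of `U` lies above all other elements of `U`. -/
def IsTop (U : Finset α) (R : Finset (α × α)) (a : α) : Prop :=
  a ∈ U ∧ ∀ b ∈ U, b ≠ a → (b, a) ∈ R

open Classical in
/-- The finset of arrangements of `U`. -/
noncomputable def arrangements (U : Finset α) : Finset (Finset (α × α)) :=
  (U ×ˢ U).powerset.filter (IsArrangement U)

open Classical in
/-- The finset of interpolative arrangements of `U`. -/
noncomputable def denseArrangements (U : Finset α) : Finset (Finset (α × α)) :=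
  (arrangements U).filter IsInterpolative

open Classical in
/-- The interpolative arrangements of `U` whose top elements are related to themselves. -/
noncomputable def topDenseArrangements (U : Finset α) : Finset (Finset (α × α)) :=
  (denseArrangements U).filter fun R => ∀ a, IsTop U R a → (a, a) ∈ R

open Classical in
/-- The elements of `U` that are not top elements. -/
noncomputable def belowTop (U : Finset α) (R : Finset (α × α)) : Finset α :=
  U.filter fun a => ¬ IsTop U R a

open Classical in
/-- The restriction of a relation to a finset. -/
noncomputable def restrictTo (V : Finset α) (R : Finset (α × α)) : Finset (α × α) :=
  R.filter fun p => p.1 ∈ V ∧ p.2 ∈ V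

open Classical in
/-- The extension of a relation on `V ⊆ U` by the new top class `U \ V`, whose elements are related
to each other (and themselves) if `b` is true, and unrelated otherwise. -/
noncomputable def extendTop (U V : Finset α) (b : Bool) (R : Finset (α × α)) : Finset (α × α) :=
  R ∪ V ×ˢ (U \ V) ∪ if b then (U \ V) ×ˢ (U \ V) else ∅

variable {U V : Finset α} {R : Finset (α × α)} {a b : α}

theorem mem_arrangements : R ∈ arrangements U ↔ IsArrangement U R := by
  simp only [arrangements, Finset.mem_filter, Finset.mem_powerset, and_iff_right_iff_imp]
  rintro h ⟨a, b⟩ hab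
  exact Finset.mem_product.2 ⟨h.left_mem hab, h.right_mem hab⟩

theorem mem_denseArrangements :
    R ∈ denseArrangements U ↔ IsArrangement U R ∧ IsInterpolative R := by
  simp [denseArrangements, mem_arrangements]

theorem mem_topDenseArrangements :
    R ∈ topDenseArrangements U ↔
      (IsArrangement U R ∧ IsInterpolative R) ∧ ∀ a, IsTop U R a → (a, a) ∈ R := by
  simp [topDenseArrangements, mem_denseArrangements]

theorem topDenseArrangements_subset_arrangements :
    topDenseArrangements U ⊆ arrangements U :=
  fun _ hR => mem_arrangements.2 (mem_topDenseArrangements.1 hR).1.1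

theorem mem_belowTop : a ∈ belowTop U R ↔ a ∈ U ∧ ¬ IsTop U R a := by simp [belowTop]

theorem belowTop_subset : belowTop U R ⊆ U := fun _ ha => (mem_belowTop.1 ha).1

theorem mem_restrictTo : (a, b) ∈ restrictTo V R ↔ (a, b) ∈ R ∧ a ∈ V ∧ b ∈ V := by
  simp [restrictTo]

theorem mem_extendTop {t : Bool} :
    (a, b) ∈ extendTop U V t R ↔
      (a, b) ∈ R ∨ (a ∈ V ∧ b ∈ U ∧ b ∉ V) ∨ (t = true ∧ (a ∈ U ∧ a ∉ V) ∧ b ∈ U ∧ b ∉ V) := by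
  cases t <;> simp [extendTop]

theorem arrangements_empty : arrangements (∅ : Finset α) = {∅} := by
  ext R
  rw [mem_arrangements, Finset.mem_singleton]
  refine ⟨fun h => Finset.eq_empty_of_forall_notMem fun ⟨a, b⟩ hab => ?_, ?_⟩
  · exact Finset.notMem_empty _ (h.left_mem hab)
  · rintro rfl
    constructor <;> simp

theorem IsArrangement.restrictTo (h : IsArrangement U R) (hV : V ⊆ U) :
    IsArrangement V (restrictTo V R) where
  left_mem hab := (mem_restrictTo.1 hab).2.1
  right_mem hab := (mem_restrictTo.1 hab).2.2
  trans hab hbc := by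
    rw [mem_restrictTo] at *
    exact ⟨h.trans hab.1 hbc.1, hab.2.1, hbc.2.2⟩
  total ha hb hne := by
    simp only [mem_restrictTo, ha, hb, and_self, and_true]
    exact h.total (hV ha) (hV hb) hne

theorem IsArrangement.exists_isTop (h : IsArrangement U R) (hU : U.Nonempty) :
    ∃ a, IsTop U R a := by
  classical
  induction U using Finset.induction_on generalizing R with
  | empty => exact (Finset.not_nonempty_empty hU).elim
  | insert x U hx ih =>
    rcases U.eq_empty_or_nonempty with rfl | hne
    · exact ⟨x, by simp [IsTop]⟩
    obtain ⟨a, ha, hatop⟩ := ih (h.restrictTo (Finset.subset_insert x U)) hne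
    have hbelow : ∀ b ∈ U, b ≠ a → (b, a) ∈ R := fun b hb hba =>
      (mem_restrictTo.1 (hatop b hb hba)).1
    have hxU := Finset.mem_insert_self x U
    have haU := Finset.mem_insert_of_mem (b := x) ha
    rcases h.total hxU haU (ne_of_mem_of_not_mem ha hx).symm with hxa | hax
    · refine ⟨a, haU, fun b hb hba => ?_⟩
      rcases Finset.mem_insert.1 hb with rfl | hb
      exacts [hxa, hbelow b hb hba]
    · refine ⟨x, hxU, fun b hb hbx => ?_⟩
      by_cases hba : b = a
      · exact hba ▸ hax
      · exact h.trans (hbelow b (Finset.mem_of_mem_insert_of_ne hb hbx) hba) hax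

theorem IsArrangement.belowTop_ssubset (h : IsArrangement U R) (hU : U.Nonempty) :
    belowTop U R ⊂ U := by
  obtain ⟨a, ha⟩ := h.exists_isTop hU
  exact (Finset.ssubset_iff_of_subset belowTop_subset).2
    ⟨a, ha.1, fun hb => (mem_belowTop.1 hb).2 ha⟩

theorem IsArrangement.isTop_of_rel (h : IsArrangement U R) (ha : IsTop U R a) (hab : (a, b) ∈ R) :
    IsTop U R b := by
  refine ⟨h.right_mem hab, fun c hc _ => ?_⟩
  by_cases hca : c = a
  · rwa [hca]
  · exact h.trans (ha.2 c hc hca) hab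

theorem IsArrangement.isInterpolative_restrictTo (h : IsArrangement U R) (hR : IsInterpolative R) :
    IsInterpolative (LinHom.restrictTo (belowTop U R) R) := by
  intro a b hab
  obtain ⟨hab, ha, hb⟩ := mem_restrictTo.1 hab
  obtain ⟨c, hac, hcb⟩ := hR a b hab
  have hc : c ∈ belowTop U R :=
    mem_belowTop.2 ⟨h.right_mem hac, fun hc => (mem_belowTop.1 hb).2 (h.isTop_of_rel hc hcb)⟩
  exact ⟨c, mem_restrictTo.2 ⟨hac, ha, hc⟩, mem_restrictTo.2 ⟨hcb, hc, hb⟩⟩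

theorem IsArrangement.extendTop_restrictTo (h : IsArrangement U R) {t : Bool}
    (ht : ∀ x y, IsTop U R x → IsTop U R y → ((x, y) ∈ R ↔ t = true)) :
    extendTop U (belowTop U R) t (LinHom.restrictTo (belowTop U R) R) = R := by
  ext ⟨x, y⟩
  simp only [mem_extendTop, mem_restrictTo, mem_belowTop, not_and, not_not]
  constructor
  · rintro (hxy | ⟨hx, hyU, hy⟩ | ⟨rfl, ⟨hxU, hx⟩, hyU, hy⟩)
    · exact hxy.1
    · exact (hy hyU).2 x hx.1 fun hxy => hx.2 (hxy ▸ hy hyU)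
    · exact (ht x y (hx hxU) (hy hyU)).2 rfl
  · intro hxy
    have hx := h.left_mem hxy
    have hy := h.right_mem hxy
    by_cases hxt : IsTop U R x <;> by_cases hyt : IsTop U R y
    · simp [hx, hy, hxt, hyt, (ht x y hxt hyt).1 hxy]
    · exact (hyt (h.isTop_of_rel hxt hxy)).elim
    · simp [hx, hy, hxt, hyt]
    · simp [hx, hy, hxt, hyt, hxy]

theorem topDenseArrangements_subset_biUnion [DecidableEq α] (hU : U.Nonempty) :
    topDenseArrangements U ⊆
      U.ssubsets.biUnion fun V => (denseArrangements V).image (extendTop U V true) := by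
  intro R hR
  obtain ⟨⟨h, hi⟩, htop⟩ := mem_topDenseArrangements.1 hR
  refine Finset.mem_biUnion.2 ⟨belowTop U R, Finset.mem_ssubsets.2 (h.belowTop_ssubset hU),
    Finset.mem_image.2 ⟨_, mem_denseArrangements.2 ⟨h.restrictTo belowTop_subset,
      h.isInterpolative_restrictTo hi⟩, h.extendTop_restrictTo fun x y hx hy => ?_⟩⟩
  simp only [iff_true]
  by_cases hxy : x = y
  · exact hxy ▸ htop x hx
  · exact hy.2 x hx.1 hxy

theorem IsArrangement.isTop_iff_eq_of_notMem (h : IsArrangement U R) (ha : IsTop U R a)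
    (haa : (a, a) ∉ R) : IsTop U R b ↔ b = a := by
  refine ⟨fun hb => ?_, fun hb => hb ▸ ha⟩
  by_contra hba
  exact haa (h.trans (hb.2 a ha.1 (Ne.symm hba)) (ha.2 b hb.1 hba))

theorem IsArrangement.belowTop_eq_erase [DecidableEq α] (h : IsArrangement U R) (ha : IsTop U R a)
    (haa : (a, a) ∉ R) : belowTop U R = U.erase a := by
  ext b
  rw [mem_belowTop, h.isTop_iff_eq_of_notMem ha haa, Finset.mem_erase, and_comm]

-- Interpolating between a top element below `c` and `c` itself shows that it is repeated.
theorem restrictTo_mem_topDenseArrangements [DecidableEq α] {c : α} (h : IsArrangement U R)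
    (hi : IsInterpolative R) (hc : IsTop U R c) (hcc : (c, c) ∉ R) :
    restrictTo (U.erase c) R ∈ topDenseArrangements (U.erase c) := by
  refine mem_topDenseArrangements.2 ⟨⟨h.restrictTo (Finset.erase_subset c U),
    h.belowTop_eq_erase hc hcc ▸ h.isInterpolative_restrictTo hi⟩, fun d hd => ?_⟩
  obtain ⟨hdc, hdU⟩ := Finset.mem_erase.1 hd.1
  obtain ⟨e, hde, hec⟩ := hi d c (hc.2 d hdU hdc)
  refine mem_restrictTo.2 ⟨?_, hd.1, hd.1⟩
  by_cases hed : e = d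
  · rwa [hed] at hde
  · have he : e ∈ U.erase c :=
      Finset.mem_erase.2 ⟨fun hec' => hcc (hec' ▸ hec), h.left_mem hec⟩
    exact h.trans hde (mem_restrictTo.1 (hd.2 e he hed)).1

theorem denseArrangements_subset_union [DecidableEq α] :
    denseArrangements U ⊆ topDenseArrangements U ∪ U.biUnion fun c =>
      (topDenseArrangements (U.erase c)).image (extendTop U (U.erase c) false) := by
  intro R hR
  obtain ⟨h, hi⟩ := mem_denseArrangements.1 hR
  by_cases htop : ∀ a, IsTop U R a → (a, a) ∈ R
  · exact Finset.mem_union_left _ (mem_topDenseArrangements.2 ⟨⟨h, hi⟩, htop⟩)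
  push Not at htop
  obtain ⟨c, hc, hcc⟩ := htop
  refine Finset.mem_union_right _ (Finset.mem_biUnion.2 ⟨c, hc.1, Finset.mem_image.2
    ⟨_, restrictTo_mem_topDenseArrangements h hi hc hcc, ?_⟩⟩)
  rw [← h.belowTop_eq_erase hc hcc]
  refine h.extendTop_restrictTo fun x y hx hy => ?_
  rw [(h.isTop_iff_eq_of_notMem hc hcc).1 hx, (h.isTop_iff_eq_of_notMem hc hcc).1 hy]
  simpa using hcc

theorem card_topDenseArrangements_le_sum [DecidableEq α] (hU : U.Nonempty) :
    (topDenseArrangements U).card ≤ ∑ V ∈ U.ssubsets, (denseArrangements V).card :=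
  (Finset.card_le_card (topDenseArrangements_subset_biUnion hU)).trans
    (Finset.card_biUnion_le.trans (Finset.sum_le_sum fun _ _ => Finset.card_image_le))

theorem card_denseArrangements_le_add_sum [DecidableEq α] :
    (denseArrangements U).card ≤
      (topDenseArrangements U).card + ∑ c ∈ U, (topDenseArrangements (U.erase c)).card :=
  (Finset.card_le_card denseArrangements_subset_union).trans <|
    (Finset.card_union_le _ _).trans <| Nat.add_le_add_left
      (Finset.card_biUnion_le.trans (Finset.sum_le_sum fun _ _ => Finset.card_image_le)) _

theorem choose_mul_factorial_mul_pow {u j : ℕ} (hj : j ≤ u) {r : ℝ} (hr : r ≠ 0) :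
    (u.choose j : ℝ) * ((u - j) ! * r ^ (u - j)) = r⁻¹ ^ j / j ! * (u ! * r ^ u) := by
  rw [← Nat.choose_mul_factorial_mul_factorial hj, pow_sub₀ r hr hj, inv_pow]
  have : (j ! : ℝ) ≠ 0 := by positivity
  push_cast
  field_simp

theorem sum_powerset_factorial_mul_pow (U : Finset α) {r : ℝ} (hr : r ≠ 0) :
    ∑ V ∈ U.powerset, (V.card ! * r ^ V.card : ℝ) =
      (∑ j ∈ Finset.range (U.card + 1), r⁻¹ ^ j / j !) * (U.card ! * r ^ U.card) := by
  rw [Finset.sum_powerset_apply_card (fun j => (j ! * r ^ j : ℝ)),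
    ← Finset.sum_range_reflect, Finset.sum_mul]
  refine Finset.sum_congr rfl fun j hj => ?_
  have hj := Finset.mem_range_succ_iff.1 hj
  rw [Nat.add_sub_cancel, Nat.choose_symm hj, nsmul_eq_mul, choose_mul_factorial_mul_pow hj hr]

theorem sum_ssubsets_factorial_mul_pow [DecidableEq α] (U : Finset α) {r : ℝ} (hr : r ≠ 0) :
    ∑ V ∈ U.ssubsets, (V.card ! * r ^ V.card : ℝ) =
      ((∑ j ∈ Finset.range (U.card + 1), r⁻¹ ^ j / j !) - 1) * (U.card ! * r ^ U.card) := by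
  rw [sub_mul, ← sum_powerset_factorial_mul_pow U hr, one_mul, eq_sub_iff_add_eq, Finset.ssubsets,
    Finset.sum_erase_add _ _ (Finset.mem_powerset_self U)]

theorem sum_erase_factorial_mul_pow [DecidableEq α] (hU : U.Nonempty) {r : ℝ} (hr : r ≠ 0) :
    ∑ c ∈ U, ((U.erase c).card ! * r ^ (U.erase c).card : ℝ) = r⁻¹ * (U.card ! * r ^ U.card) := by
  have h := choose_mul_factorial_mul_pow (Finset.card_pos.2 hU) hr
  simp only [Nat.succ_eq_add_one, zero_add, Nat.choose_one_right, pow_one, Nat.factorial_one,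
    Nat.cast_one, div_one] at h
  rw [Finset.sum_congr rfl fun c hc => by rw [Finset.card_erase_of_mem hc], Finset.sum_const,
    nsmul_eq_mul, h]

theorem sum_half_pow_div_factorial_le (u : ℕ) :
    ∑ j ∈ Finset.range u, (2 : ℝ)⁻¹ ^ j / j ! ≤ 5 / 3 := by
  refine (Real.sum_le_exp_of_nonneg (by norm_num) u).trans ?_
  have hsq : Real.exp 2⁻¹ * Real.exp 2⁻¹ = Real.exp 1 := by
    rw [← Real.exp_add]
    norm_num
  nlinarith [Real.exp_one_lt_d9, Real.exp_pos 2⁻¹]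

theorem card_denseArrangements_le_of_topDense
    (h : ∀ V ⊆ U, ((topDenseArrangements V).card : ℝ) ≤ V.card ! * 2 ^ V.card) :
    ((denseArrangements U).card : ℝ) ≤ 3 / 2 * (U.card ! * 2 ^ U.card) := by
  classical
  have hsum : ∑ c ∈ U, ((topDenseArrangements (U.erase c)).card : ℝ) ≤
      2⁻¹ * (U.card ! * 2 ^ U.card) := by
    rcases U.eq_empty_or_nonempty with rfl | hU
    · simp
    · rw [← sum_erase_factorial_mul_pow hU two_ne_zero]
      exact Finset.sum_le_sum fun c _ => h _ (Finset.erase_subset c U)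
  calc ((denseArrangements U).card : ℝ)
      ≤ (topDenseArrangements U).card + ∑ c ∈ U, ((topDenseArrangements (U.erase c)).card : ℝ) := by
        exact_mod_cast card_denseArrangements_le_add_sum
    _ ≤ U.card ! * 2 ^ U.card + 2⁻¹ * (U.card ! * 2 ^ U.card) := add_le_add (h U subset_rfl) hsum
    _ = 3 / 2 * (U.card ! * 2 ^ U.card) := by ring

theorem card_topDenseArrangements_le (U : Finset α) :
    ((topDenseArrangements U).card : ℝ) ≤ U.card ! * 2 ^ U.card := by
  classical
  induction U using Finset.strongInduction with
  | H U ih =>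
  rcases U.eq_empty_or_nonempty with rfl | hU
  · simpa [arrangements_empty] using
      Finset.card_le_card (topDenseArrangements_subset_arrangements (U := (∅ : Finset α)))
  calc ((topDenseArrangements U).card : ℝ)
      ≤ ∑ V ∈ U.ssubsets, ((denseArrangements V).card : ℝ) := by
        exact_mod_cast card_topDenseArrangements_le_sum hU
    _ ≤ ∑ V ∈ U.ssubsets, 3 / 2 * (V.card ! * 2 ^ V.card : ℝ) :=
        Finset.sum_le_sum fun V hV => card_denseArrangements_le_of_topDense fun W hW =>
          ih W (hW.trans_ssubset (Finset.mem_ssubsets.1 hV))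
    _ = 3 / 2 * ((∑ j ∈ Finset.range (U.card + 1), (2 : ℝ)⁻¹ ^ j / j !) - 1) *
          (U.card ! * 2 ^ U.card) := by
        rw [← Finset.mul_sum, sum_ssubsets_factorial_mul_pow U two_ne_zero, mul_assoc]
    _ ≤ 1 * (U.card ! * 2 ^ U.card) := by
        gcongr
        linarith [sum_half_pow_div_factorial_le (U.card + 1)]
    _ = U.card ! * 2 ^ U.card := one_mul _

theorem card_denseArrangements_le (U : Finset α) :
    ((denseArrangements U).card : ℝ) ≤ 3 / 2 * (U.card ! * 2 ^ U.card) :=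
  card_denseArrangements_le_of_topDense fun V _ => card_topDenseArrangements_le V

theorem sum_card_denseArrangements_le (U : Finset α) :
    ∑ V ∈ U.powerset, ((denseArrangements V).card : ℝ) ≤ 5 / 2 * (U.card ! * 2 ^ U.card) :=
  calc ∑ V ∈ U.powerset, ((denseArrangements V).card : ℝ)
      ≤ ∑ V ∈ U.powerset, 3 / 2 * (V.card ! * 2 ^ V.card : ℝ) :=
        Finset.sum_le_sum fun V _ => card_denseArrangements_le V
    _ = 3 / 2 * (∑ j ∈ Finset.range (U.card + 1), (2 : ℝ)⁻¹ ^ j / j !) *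
          (U.card ! * 2 ^ U.card) := by
        rw [← Finset.mul_sum, sum_powerset_factorial_mul_pow U two_ne_zero, mul_assoc]
    _ ≤ 3 / 2 * (5 / 3) * (U.card ! * 2 ^ U.card) := by
        gcongr
        exact sum_half_pow_div_factorial_le _
    _ = 5 / 2 * (U.card ! * 2 ^ U.card) := by ring

theorem IsArrangement.extendTop (h : IsArrangement V R) (hV : V ⊆ U) {t : Bool}
    (ht : t = true ∨ (U \ V : Set α).Subsingleton) :
    IsArrangement U (extendTop U V t R) where
  left_mem hab := by
    rcases mem_extendTop.1 hab with hab | hab | hab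
    exacts [hV (h.left_mem hab), hV hab.1, hab.2.1.1]
  right_mem hab := by
    rcases mem_extendTop.1 hab with hab | hab | hab
    exacts [hV (h.right_mem hab), hab.2.1, hab.2.2.1]
  trans hab hbc := by
    simp only [mem_extendTop] at *
    grind [h.left_mem, h.right_mem, h.trans]
  total {a b} ha hb hne := by
    simp only [mem_extendTop]
    by_cases haV : a ∈ V <;> by_cases hbV : b ∈ V
    · exact (h.total haV hbV hne).imp .inl .inl
    · exact .inl (.inr (.inl ⟨haV, hb, hbV⟩))
    · exact .inr (.inr (.inl ⟨hbV, ha, haV⟩))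
    · have ht := ht.resolve_right fun hs => hne (hs ⟨ha, haV⟩ ⟨hb, hbV⟩)
      exact .inl (.inr (.inr ⟨ht, ⟨ha, haV⟩, hb, hbV⟩))

theorem IsArrangement.belowTop_extendTop (h : IsArrangement V R) (hV : V ⊂ U) {t : Bool}
    (ht : t = true ∨ (U \ V : Set α).Subsingleton) : belowTop U (LinHom.extendTop U V t R) = V := by
  obtain ⟨c, hcU, hcV⟩ := Finset.exists_of_ssubset hV
  ext a
  rw [mem_belowTop]
  constructor
  · rintro ⟨haU, ha⟩
    by_contra haV
    refine ha ⟨haU, fun b hbU hba => mem_extendTop.2 (.inr ?_)⟩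
    by_cases hbV : b ∈ V
    · exact .inl ⟨hbV, haU, haV⟩
    · exact .inr ⟨ht.resolve_right fun hs => hba (hs ⟨hbU, hbV⟩ ⟨haU, haV⟩), ⟨hbU, hbV⟩, haU, haV⟩
  · refine fun haV => ⟨hV.subset haV, fun ha => ?_⟩
    rcases mem_extendTop.1 (ha.2 c hcU fun hca => hcV (hca ▸ haV)) with hca | hca | hca
    exacts [hcV (h.left_mem hca), hcV hca.1, hca.2.2.2 haV]

theorem IsArrangement.restrictTo_extendTop (h : IsArrangement V R) (t : Bool) :
    LinHom.restrictTo V (LinHom.extendTop U V t R) = R := by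
  ext ⟨a, b⟩
  rw [mem_restrictTo, mem_extendTop]
  exact ⟨fun ⟨hab, _, hb⟩ => hab.resolve_right (by simp [hb]),
    fun hab => ⟨.inl hab, h.left_mem hab, h.right_mem hab⟩⟩

theorem IsArrangement.mem_extendTop_self_iff (h : IsArrangement V R) {t : Bool} (haU : a ∈ U)
    (haV : a ∉ V) : (a, a) ∈ LinHom.extendTop U V t R ↔ t = true := by
  have haa : (a, a) ∉ R := fun haa => haV (h.left_mem haa)
  simp [mem_extendTop, haa, haU, haV]

theorem sum_card_arrangements_le (J : Finset (Finset α × Bool))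
    (hJ : ∀ p ∈ J, p.1 ⊂ U ∧ (p.2 = true ∨ (U \ p.1 : Set α).Subsingleton)) :
    ∑ p ∈ J, (arrangements p.1).card ≤ (arrangements U).card := by
  rw [← Finset.card_sigma]
  refine Finset.card_le_card_of_injOn (fun x => extendTop U x.1.1 x.1.2 x.2) ?_ ?_
  · rintro ⟨p, R⟩ hx
    obtain ⟨hp, hR⟩ := Finset.mem_sigma.1 hx
    exact mem_arrangements.2 ((mem_arrangements.1 hR).extendTop (hJ p hp).1.subset (hJ p hp).2)
  -- The lower part is recovered from the top elements, the flag from reflexivity at the top.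
  · rintro ⟨⟨V, t⟩, R⟩ hx ⟨⟨V', t'⟩, R'⟩ hx' heq
    obtain ⟨hp, hR⟩ := Finset.mem_sigma.1 hx
    obtain ⟨hp', hR'⟩ := Finset.mem_sigma.1 hx'
    obtain ⟨hV, ht⟩ := hJ _ hp
    obtain ⟨hV', ht'⟩ := hJ _ hp'
    simp only [mem_arrangements] at heq hV ht hV' ht' hR hR'
    obtain rfl : V = V' := by
      rw [← hR.belowTop_extendTop hV ht, heq, hR'.belowTop_extendTop hV' ht']
    obtain ⟨a, haU, haV⟩ := Finset.exists_of_ssubset hV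
    obtain rfl : t = t' := by
      rw [Bool.eq_iff_iff, ← hR.mem_extendTop_self_iff haU haV, heq,
        hR'.mem_extendTop_self_iff haU haV]
    obtain rfl : R = R' := by
      rw [← hR.restrictTo_extendTop t, heq, hR'.restrictTo_extendTop t]
    rfl

theorem sum_ssubsets_add_sum_erase_le_card_arrangements [DecidableEq α] (U : Finset α) :
    ∑ V ∈ U.ssubsets, (arrangements V).card + ∑ c ∈ U, (arrangements (U.erase c)).card ≤
      (arrangements U).card := by
  have hdisj : Disjoint (U.ssubsets ×ˢ {true}) (U.image U.erase ×ˢ {false}) :=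
    Finset.disjoint_product.2 (.inr (by simp))
  have h := sum_card_arrangements_le (U := U) (U.ssubsets ×ˢ {true} ∪ U.image U.erase ×ˢ {false})
    (by
      simp only [Finset.mem_union, Finset.mem_product, Finset.mem_ssubsets, Finset.mem_singleton,
        Finset.mem_image]
      rintro ⟨V, t⟩ (⟨hV, rfl⟩ | ⟨⟨c, hc, rfl⟩, rfl⟩)
      · exact ⟨hV, .inl rfl⟩
      · exact ⟨Finset.erase_ssubset hc, .inr fun x hx y hy => by simp at hx hy; grind⟩)
  rwa [Finset.sum_union hdisj, Finset.sum_product, Finset.sum_product,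
    Finset.sum_image (Finset.erase_injOn U)] at h

theorem one_le_sum_ssubsets_add_sum_erase_coeff {u : ℕ} (hu : 2 ≤ u) :
    (1 : ℝ) ≤ (∑ j ∈ Finset.range (u + 1), (11 / 5 : ℝ)⁻¹ ^ j / j !) - 1 + (11 / 5 : ℝ)⁻¹ := by
  have hle : ∑ j ∈ Finset.range 3, (11 / 5 : ℝ)⁻¹ ^ j / j ! ≤
      ∑ j ∈ Finset.range (u + 1), (11 / 5 : ℝ)⁻¹ ^ j / j ! :=
    Finset.sum_le_sum_of_subset_of_nonneg (Finset.range_subset_range.2 (by omega))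
      fun _ _ _ => by positivity
  norm_num [Finset.sum_range_succ] at hle ⊢
  linarith

theorem le_card_arrangements_of_nontrivial (hU : U.Nontrivial)
    (ih : ∀ V ⊂ U, 10 / 11 * (V.card ! * (11 / 5 : ℝ) ^ V.card) ≤ (arrangements V).card) :
    10 / 11 * (U.card ! * (11 / 5 : ℝ) ^ U.card) ≤ (arrangements U).card := by
  classical
  calc 10 / 11 * (U.card ! * (11 / 5 : ℝ) ^ U.card)
      ≤ 10 / 11 * (((∑ j ∈ Finset.range (U.card + 1), (11 / 5 : ℝ)⁻¹ ^ j / j !) - 1 +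
          (11 / 5 : ℝ)⁻¹) * (U.card ! * (11 / 5 : ℝ) ^ U.card)) := by
        refine mul_le_mul_of_nonneg_left ?_ (by norm_num)
        exact le_mul_of_one_le_left (by positivity)
          (one_le_sum_ssubsets_add_sum_erase_coeff (Finset.one_lt_card_iff_nontrivial.2 hU))
    _ = ∑ V ∈ U.ssubsets, 10 / 11 * (V.card ! * (11 / 5 : ℝ) ^ V.card) +
          ∑ c ∈ U, 10 / 11 * ((U.erase c).card ! * (11 / 5 : ℝ) ^ (U.erase c).card) := by
        rw [add_mul, mul_add, ← sum_ssubsets_factorial_mul_pow U (by norm_num),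
          ← sum_erase_factorial_mul_pow hU.nonempty (by norm_num), Finset.mul_sum, Finset.mul_sum]
    _ ≤ ∑ V ∈ U.ssubsets, ((arrangements V).card : ℝ) +
          ∑ c ∈ U, ((arrangements (U.erase c)).card : ℝ) :=
        add_le_add (Finset.sum_le_sum fun V hV => ih V (Finset.mem_ssubsets.1 hV))
          (Finset.sum_le_sum fun c hc => ih _ (Finset.erase_ssubset hc))
    _ ≤ (arrangements U).card := by
        exact_mod_cast sum_ssubsets_add_sum_erase_le_card_arrangements U

theorem two_le_card_arrangements_singleton (a : α) : 2 ≤ (arrangements {a}).card := by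
  classical
  have hss : ({a} : Finset α).ssubsets = {∅} := by
    ext V
    simp [Finset.ssubset_singleton_iff]
  simpa [hss, arrangements_empty] using sum_ssubsets_add_sum_erase_le_card_arrangements {a}

-- The constant `10 / 11` makes this an equality for singletons.
theorem le_card_arrangements (U : Finset α) :
    10 / 11 * (U.card ! * (11 / 5 : ℝ) ^ U.card) ≤ (arrangements U).card := by
  classical
  induction U using Finset.strongInduction with
  | H U ih =>
  rcases U.eq_empty_or_nonempty with rfl | hU
  · norm_num [arrangements_empty]
  rcases hU.exists_eq_singleton_or_nontrivial with ⟨a, rfl⟩ | hU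
  · norm_num
    exact two_le_card_arrangements_singleton a
  · exact le_card_arrangements_of_nontrivial hU ih

end Counting

section Ultrahomogeneous

theorem encard_image_le_of_invariant {T β ι : Type*} {f : T → β} {inv : T → ι} {P : Set T}
    {V : Set ι} (hV : Set.MapsTo inv P V)
    (hinv : ∀ X ∈ P, ∀ Y ∈ P, inv X = inv Y → f X = f Y) : (f '' P).encard ≤ V.encard := by
  obtain ⟨Q, hQP, hQ⟩ := Set.exists_subset_bijOn P f
  have hinj : Q.InjOn inv := fun X hX Y hY h => hQ.injOn hX hY (hinv X (hQP hX) Y (hQP hY) h)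
  rw [← hQ.image_eq, hQ.injOn.encard_image, ← hinj.encard_image]
  exact Set.encard_le_encard ((hV.mono_left hQP).image_subset)

theorem exists_equiv_of_isUltrahomogeneous {L : Language} [L.IsRelational] {M : Type*}
    [L.Structure M] (hM : L.IsUltrahomogeneous M) {A : Set M} (hA : A.Finite) (f : A → M)
    (hf : Function.Injective f)
    (hrel : ∀ {n} (r : L.Relations n) (v : Fin n → A),
      Language.Structure.RelMap r (f ∘ v) ↔ Language.Structure.RelMap r fun i => (v i : M)) :
    ∃ g : M ≃[L] M, ∀ x : A, g x = f x := by
  let toA : Language.Substructure.closure L A → A := fun x =>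
    ⟨x, (Language.Substructure.mem_closure_iff_of_isRelational L A x).1 x.2⟩
  let F : Language.Substructure.closure L A ↪[L] M :=
    { toFun := f ∘ toA
      inj' := fun x y h => Subtype.ext (congrArg (fun a : A => (a : M)) (hf h))
      map_fun' := fun c => isEmptyElim c
      map_rel' := fun r v => hrel r (toA ∘ v) }
  obtain ⟨g, hg⟩ := hM _ (Language.Substructure.fg_closure hA) F
  exact ⟨g, fun x => (DFunLike.congr_fun hg ⟨x, Language.Substructure.subset_closure x.2⟩).symm⟩

end Ultrahomogeneous

section Colored

variable {k : ℕ}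

instance : (ColorLang k).IsRelational := fun _ => inferInstanceAs (IsEmpty Empty)

instance (X : ColoredLinOrd k) : Countable X.carrier := X.countable

theorem exists_strictMono_of_isUltrahomogeneous {X : ColoredLinOrd k}
    (hX : (ColorLang k).IsUltrahomogeneous X.carrier) {F : Finset (X.carrier × X.carrier)}
    (hF : IsPartialIso X.color X.color F) :
    ∃ g : X.carrier → X.carrier, StrictMono g ∧ (∀ x, X.color (g x) = X.color x) ∧
      ∀ p ∈ F, g p.1 = p.2 := by
  have hdom : ∀ x : Prod.fst '' (F : Set (X.carrier × X.carrier)), ∃ y, (x.1, y) ∈ F := by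
    rintro ⟨-, p, hp, rfl⟩
    exact ⟨p.2, hp⟩
  choose f hf using hdom
  obtain ⟨g, hg⟩ := exists_equiv_of_isUltrahomogeneous hX (F.finite_toSet.image Prod.fst) f
    (fun x y hxy => Subtype.ext ((hF.eq_iff (hf x) (hf y)).2 hxy)) fun r v => by
      cases r with
      | lt => exact (hF.2 _ (hf (v 0)) _ (hf (v 1))).symm
      | color i => exact Eq.congr_left (hF.1 _ (hf (v 0)))
  refine ⟨g, fun x y hxy => ?_, fun x => ?_, fun p hp => ?_⟩
  · exact (g.map_rel (ColorRel.lt : (ColorLang k).Relations 2) ![x, y]).2 hxy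
  · exact (g.map_rel (ColorRel.color (X.color x) : (ColorLang k).Relations 1) ![x]).2 rfl
  · let x : Prod.fst '' (F : Set (X.carrier × X.carrier)) := ⟨p.1, p, hp, rfl⟩
    exact (hg x).trans ((hF.eq_iff (hf x) hp).1 rfl)

theorem IsSaturated.isUltrahomogeneous {X : ColoredLinOrd k} (hX : IsSaturated X.color) :
    (ColorLang k).IsUltrahomogeneous X.carrier := by
  classical
  intro S hS f
  have := hS.finite
  have := Fintype.ofFinite S
  have hF : IsPartialIso X.color X.color (Finset.univ.image fun x : S => (x.1, f x)) := by
    simp only [IsPartialIso, Finset.forall_mem_image, Finset.mem_univ, true_imp_iff]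
    constructor
    · intro x
      exact (f.map_rel (ColorRel.color (X.color x.1) : (ColorLang k).Relations 1) ![x]).2 rfl
    · intro x y
      exact (f.map_rel (ColorRel.lt : (ColorLang k).Relations 2) ![x, y]).symm
  obtain ⟨e, hc, he⟩ := hX.exists_orderIso_extending hX rfl hF
  refine ⟨{ e.toEquiv with
      map_fun' := fun c => isEmptyElim c
      map_rel' := fun r v => by
        cases r with
        | lt => exact e.lt_iff_lt
        | color i => exact Eq.congr_left (hc (v 0)) }, ?_⟩
  ext x
  exact (he _ (Finset.mem_image_of_mem _ (Finset.mem_univ x))).symm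

theorem isUltrahomogeneous_iff_isSaturated {X : ColoredLinOrd k} :
    (ColorLang k).IsUltrahomogeneous X.carrier ↔ IsSaturated X.color :=
  ⟨fun hX => .of_forall_exists_strictMono fun _ hF => exists_strictMono_of_isUltrahomogeneous hX hF,
    IsSaturated.isUltrahomogeneous⟩

theorem colorHomTypes_finite (k : ℕ) : (colorHomTypes k).Finite := by
  refine Set.encard_lt_top_iff.1 (lt_of_le_of_lt ?_
    (Set.finite_univ (α := Set (Fin k) × Set (Fin k × Fin k))).encard_lt_top)
  refine encard_image_le_of_invariant (inv := fun X : ColoredLinOrd k => colorPattern X.color)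
    (Set.mapsTo_univ _ _) fun X hX Y hY h => Quotient.sound ?_
  exact (isUltrahomogeneous_iff_isSaturated.1 hX).exists_orderIso
    (isUltrahomogeneous_iff_isSaturated.1 hY) h

end Colored

section Realization

variable {k : ℕ} {R : Finset (Fin k × Fin k)} {c d : Fin k}

open Classical in
/-- The number of colors strictly below `c` in the preorder `R`. -/
noncomputable def colorRank (R : Finset (Fin k × Fin k)) (c : Fin k) : ℕ :=
  (Finset.univ.filter fun e => (e, c) ∈ R ∧ (c, e) ∉ R).card

theorem IsArrangement.colorRank_lt (h : IsArrangement Finset.univ R) (hcd : (c, d) ∈ R)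
    (hdc : (d, c) ∉ R) : colorRank R c < colorRank R d := by
  refine Finset.card_lt_card ((Finset.ssubset_iff_of_subset fun e he => ?_).2 ⟨c, ?_, ?_⟩)
  · simp only [Finset.mem_filter, Finset.mem_univ, true_and] at he ⊢
    exact ⟨h.trans he.1 hcd, fun hde => hdc (h.trans hde he.1)⟩
  · simp [hcd, hdc]
  · simp

theorem IsArrangement.colorRank_eq (h : IsArrangement Finset.univ R) (hcd : (c, d) ∈ R)
    (hdc : (d, c) ∈ R) : colorRank R c = colorRank R d := by
  classical
  refine congrArg Finset.card (Finset.filter_congr fun e _ => ?_)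
  exact ⟨fun he => ⟨h.trans he.1 hcd, fun hde => he.2 (h.trans hcd hde)⟩,
    fun he => ⟨h.trans he.1 hdc, fun hde => he.2 (h.trans hdc hde)⟩⟩

/-- The points of a countable colored ordering in which `ColorBefore` is `R`: a copy of `ℚ` for
each color related to itself, and a single point, labelled `0`, for each other color. -/
def Realization (R : Finset (Fin k × Fin k)) : Type :=
  {p : Fin k × ℚ // (p.1, p.1) ∈ R ∨ p.2 = 0}

namespace Realization

instance : Countable (Realization R) := inferInstanceAs (Countable (Subtype _))

/-- The color of a point. -/
def color (x : Realization R) : Fin k := x.1.1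

/-- The position of a point relative to the colors of the same rank. Translating the copies of `ℚ`
by different multiples of `√2` makes them disjoint dense subsets of `ℝ`. -/
noncomputable def pos (x : Realization R) : ℝ := x.1.2 + x.1.1 * √2

/-- The point labelled `0` of each color. -/
def base (c : Fin k) : Realization R := ⟨(c, 0), Or.inr rfl⟩

theorem pos_injective : Function.Injective (pos (R := R)) := by
  rintro ⟨⟨c, q⟩, hx⟩ ⟨⟨d, r⟩, hy⟩ h
  simp only [pos] at h
  obtain rfl : c = d := by
    by_contra hne
    have hsub : ((c.1 : ℤ) - d.1 : ℤ) ≠ 0 := fun hcd => hne (Fin.ext (by omega))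
    refine (irrational_sqrt_two.intCast_mul hsub).ne_rat (r - q) ?_
    push_cast
    linarith
  obtain rfl : q = r := by exact_mod_cast add_right_cancel h
  rfl

noncomputable instance : LinearOrder (Realization R) :=
  LinearOrder.lift' (fun x => toLex (colorRank R x.color, x.pos)) fun _ _ h =>
    pos_injective (congrArg (fun r => (ofLex r).2) h)

theorem lt_iff {x y : Realization R} : x < y ↔ colorRank R x.color < colorRank R y.color ∨
    colorRank R x.color = colorRank R y.color ∧ x.pos < y.pos :=
  Prod.Lex.lt_iff (x := toLex (colorRank R x.color, x.pos))
    (y := toLex (colorRank R y.color, y.pos))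

theorem exists_pos_between (hc : (c, c) ∈ R) {a b : ℝ} (hab : a < b) :
    ∃ x : Realization R, x.color = c ∧ a < x.pos ∧ x.pos < b := by
  obtain ⟨q, haq, hqb⟩ := exists_rat_btwn (sub_lt_sub_right hab (c * √2))
  exact ⟨⟨(c, q), Or.inl hc⟩, rfl, sub_lt_iff_lt_add.1 haq, lt_sub_iff_add_lt.1 hqb⟩

theorem color_rel_of_lt (h : IsArrangement Finset.univ R) {x y : Realization R}
    (hxy : x < y) : (x.color, y.color) ∈ R := by
  by_contra hn
  by_cases hc : x.color = y.color
  · refine hxy.ne (Subtype.ext (Prod.ext hc ?_))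
    rw [x.2.resolve_left fun hx => hn (hc ▸ hx), y.2.resolve_left fun hy => hn (hc.symm ▸ hy)]
  · have hyx := (h.total (Finset.mem_univ _) (Finset.mem_univ _) hc).resolve_left hn
    have hlt := h.colorRank_lt hyx hn
    rcases lt_iff.1 hxy with hlt' | ⟨heq, -⟩
    exacts [lt_asymm hlt hlt', hlt.ne' heq]

theorem exists_above (h : IsArrangement Finset.univ R) (x : Realization R)
    (hc : (x.color, c) ∈ R) : ∃ y, x < y ∧ y.color = c := by
  by_cases hcx : (c, x.color) ∈ R
  · obtain ⟨y, rfl, hxy, -⟩ := exists_pos_between (h.trans hcx hc) (lt_add_one x.pos)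
    exact ⟨y, lt_iff.2 (.inr ⟨h.colorRank_eq hc hcx, hxy⟩), rfl⟩
  · exact ⟨base c, lt_iff.2 (.inl (h.colorRank_lt hc hcx)), rfl⟩

theorem exists_below (h : IsArrangement Finset.univ R) (x : Realization R)
    (hc : (c, x.color) ∈ R) : ∃ y, y < x ∧ y.color = c := by
  by_cases hxc : (x.color, c) ∈ R
  · obtain ⟨y, rfl, -, hyx⟩ := exists_pos_between (h.trans hc hxc) (sub_one_lt x.pos)
    exact ⟨y, lt_iff.2 (.inr ⟨h.colorRank_eq hc hxc, hyx⟩), rfl⟩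
  · exact ⟨base c, lt_iff.2 (.inl (h.colorRank_lt hc hxc)), rfl⟩

theorem exists_between (h : IsArrangement Finset.univ R) {x y : Realization R} (hxy : x < y)
    (hxc : (x.color, c) ∈ R) (hcy : (c, y.color) ∈ R) : ∃ z, x < z ∧ z < y ∧ z.color = c := by
  by_cases hcx : (c, x.color) ∈ R
  · by_cases hyc : (y.color, c) ∈ R
    · have hxc' := h.colorRank_eq hxc hcx
      have hcy' := h.colorRank_eq hcy hyc
      have hpos : x.pos < y.pos :=
        ((lt_iff.1 hxy).resolve_left (hxc'.trans hcy').not_lt).2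
      obtain ⟨z, rfl, hxz, hzy⟩ := exists_pos_between (h.trans hcx hxc) hpos
      exact ⟨z, lt_iff.2 (.inr ⟨hxc', hxz⟩), lt_iff.2 (.inr ⟨hcy', hzy⟩), rfl⟩
    · obtain ⟨z, hxz, rfl⟩ := exists_above h x hxc
      exact ⟨z, hxz, lt_iff.2 (.inl (h.colorRank_lt hcy hyc)), rfl⟩
  · obtain ⟨z, hzy, rfl⟩ := exists_below h y hcy
    exact ⟨z, lt_iff.2 (.inl (h.colorRank_lt hxc hcx)), hzy, rfl⟩

theorem colorBefore_iff (h : IsArrangement Finset.univ R) :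
    ColorBefore (color (R := R)) c d ↔ (c, d) ∈ R := by
  constructor
  · rintro ⟨x, y, hxy, rfl, rfl⟩
    exact color_rel_of_lt h hxy
  · intro hcd
    obtain ⟨y, hy, hyd⟩ := exists_above h (base c) hcd
    exact ⟨_, y, hy, rfl, hyd⟩

theorem isSaturated (h : IsArrangement Finset.univ R) : IsSaturated (color (R := R)) where
  between _ _ _ hxy hxc hcy :=
    exists_between h hxy ((colorBefore_iff h).1 hxc) ((colorBefore_iff h).1 hcy)
  above x _ hc := exists_above h x ((colorBefore_iff h).1 hc)
  below x _ hc := exists_below h x ((colorBefore_iff h).1 hc)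

/-- The realization of `R` as a colored linear ordering. -/
noncomputable def toColoredLinOrd (R : Finset (Fin k × Fin k)) : ColoredLinOrd k where
  carrier := Realization R
  color := color

end Realization

theorem card_arrangements_le_numColored (k : ℕ) :
    (arrangements (Finset.univ : Finset (Fin k))).card ≤ numColored k := by
  rw [← Set.ncard_coe_finset]
  refine Set.ncard_le_ncard_of_injOn
    (fun R => Quotient.mk (coloredSetoid k) (Realization.toColoredLinOrd R))
    (fun R hR => ?_) (fun R hR R' hR' heq => ?_) (colorHomTypes_finite k)
  · exact ⟨_, isUltrahomogeneous_iff_isSaturated.2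
      (Realization.isSaturated (mem_arrangements.1 hR)), rfl⟩
  · obtain ⟨e, he⟩ := Quotient.exact heq
    ext ⟨c, d⟩
    rw [← Realization.colorBefore_iff (mem_arrangements.1 hR),
      ← Realization.colorBefore_iff (mem_arrangements.1 hR')]
    exact ⟨ColorBefore.map e.strictMono he, ColorBefore.map e.symm.strictMono fun y =>
      (he (e.symm y)).symm.trans (congrArg _ (e.apply_symm_apply y))⟩

theorem le_numColored (k : ℕ) : 10 / 11 * (k ! * (11 / 5 : ℝ) ^ k) ≤ numColored k := by
  have h := le_card_arrangements (Finset.univ : Finset (Fin k))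
  rw [Finset.card_univ, Fintype.card_fin] at h
  exact h.trans (by exact_mod_cast card_arrangements_le_numColored k)

end Realization

section Blocks

variable {X Y : Type} [LinearOrder X] [LinearOrder Y]

theorem mem_block_self (x : X) : x ∈ block x := by simp [block]

theorem mem_block_symm {x y : X} (h : y ∈ block x) : x ∈ block y := by
  simpa only [block, Set.mem_ofPred_eq, Set.uIcc_comm] using h

theorem mem_block_trans {x y z : X} (h : y ∈ block x) (h' : z ∈ block y) : z ∈ block x :=
  (Set.Finite.union h h').subset Set.uIcc_subset_uIcc_union_uIcc

theorem block_eq_of_mem {x y : X} (h : y ∈ block x) : block y = block x :=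
  Set.ext fun _ => ⟨fun hz => mem_block_trans h hz, fun hz => mem_block_trans (mem_block_symm h) hz⟩

theorem mem_block_iff_of_le {x y : X} (h : x ≤ y) : y ∈ block x ↔ (Set.Icc x y).Finite := by
  rw [← Set.uIcc_of_le h]
  rfl

theorem ordConnected_block (x : X) : (block x).OrdConnected :=
  ⟨fun _ ha _ hb _ hz => mem_block_trans ha <| (mem_block_iff_of_le hz.1).2 <|
    ((mem_block_iff_of_le (hz.1.trans hz.2)).1 (mem_block_trans (mem_block_symm ha) hb)).subset
      (Set.Icc_subset_Icc_right hz.2)⟩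

theorem mem_block_of_covBy {x y : X} (h : x ⋖ y) : y ∈ block x := by
  rw [mem_block_iff_of_le h.le, h.Icc_eq]
  exact Set.toFinite _

theorem exists_covBy_le {x y : X} (hxy : x < y) (h : y ∈ block x) : ∃ z, x ⋖ z ∧ z ≤ y := by
  have hfin : (Set.Ioc x y).Finite :=
    ((mem_block_iff_of_le hxy.le).1 h).subset Set.Ioc_subset_Icc_self
  obtain ⟨z, hz, hmin⟩ := Set.exists_min_image _ id hfin ⟨y, hxy, le_rfl⟩
  exact ⟨z, ⟨hz.1, fun w hxw hwz => (hmin w ⟨hxw, hwz.le.trans hz.2⟩).not_gt hwz⟩, hz.2⟩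

theorem transGen_covBy_of_mem_block {x y : X} (hxy : x < y) (h : y ∈ block x) :
    Relation.TransGen (· ⋖ ·) x y := by
  have hfin : (Set.Ioc x y).Finite :=
    ((mem_block_iff_of_le hxy.le).1 h).subset Set.Ioc_subset_Icc_self
  induction hn : (Set.Ioc x y).ncard using Nat.strong_induction_on generalizing x with
  | _ n ih =>
  obtain ⟨z, hz, hzy⟩ := exists_covBy_le hxy h
  rcases hzy.eq_or_lt with rfl | hlt
  · exact .single hz
  · have hss : Set.Ioc z y ⊂ Set.Ioc x y :=
      ⟨Set.Ioc_subset_Ioc_left hz.le, fun hs => lt_irrefl z (hs ⟨hz.lt, hzy⟩).1⟩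
    exact .head hz (ih _ (hn ▸ Set.ncard_lt_ncard hss hfin) hlt
      (mem_block_trans (mem_block_symm (mem_block_of_covBy hz)) h) (hfin.subset hss.1) rfl)

theorem transGen_covBy_iff {x y : X} :
    Relation.TransGen (· ⋖ ·) x y ↔ x < y ∧ y ∈ block x := by
  refine ⟨fun h => ?_, fun h => transGen_covBy_of_mem_block h.1 h.2⟩
  induction h with
  | single h => exact ⟨h.lt, mem_block_of_covBy h⟩
  | tail _ h ih => exact ⟨ih.1.trans h.lt, mem_block_trans ih.2 (mem_block_of_covBy h)⟩

theorem apply_mem_block (e : X ≃o Y) {x y : X} (h : y ∈ block x) : e y ∈ block (e x) := by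
  refine (Set.Finite.image e h).subset fun z hz => ⟨e.symm z, ?_, e.apply_symm_apply z⟩
  simp only [Set.mem_uIcc] at hz ⊢
  simpa only [e.le_symm_apply, e.symm_apply_le] using hz

theorem image_block (e : X ≃o Y) (x : X) : e '' block x = block (e x) := by
  refine Set.Subset.antisymm (Set.image_subset_iff.2 fun y => apply_mem_block e) fun y hy =>
    ⟨e.symm y, ?_, e.apply_symm_apply y⟩
  simpa only [e.symm_apply_apply] using apply_mem_block e.symm hy

/-- The condensation of `X`, with each block represented by its first point. -/
abbrev BlockFirst (X : Type) [LinearOrder X] : Type := {x : X // x ∈ lowerBounds (block x)}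

/-- The number of points of the block of `x`, meaningful only if that block is finite. -/
noncomputable def blockSize (x : X) : ℕ := (block x).ncard

/-- The number of points before `x` in its block, meaningful only if there are finitely many. -/
noncomputable def blockIndex (x : X) : ℕ := (block x ∩ Set.Iio x).ncard

/-- The coloring of the condensation by the sizes of the blocks. -/
noncomputable def sizeColor (X : Type) [LinearOrder X] (a : BlockFirst X) : ℕ := blockSize a.1

theorem apply_mem_lowerBounds_block (e : X ≃o Y) (a : BlockFirst X) :
    e a ∈ lowerBounds (block (e a)) := by
  rw [← image_block]
  exact e.monotone.mem_lowerBounds_image a.2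

theorem blockSize_apply (e : X ≃o Y) (x : X) : blockSize (e x) = blockSize x := by
  rw [blockSize, blockSize, ← image_block, Set.ncard_image_of_injective _ e.injective]

theorem blockIndex_coe (a : BlockFirst X) : blockIndex a.1 = 0 := by
  have hempty : block a.1 ∩ Set.Iio a.1 = ∅ :=
    Set.eq_empty_of_forall_notMem fun y hy => not_lt.2 (a.2 hy.1) hy.2
  rw [blockIndex, hempty, Set.ncard_empty]

variable (X) in
/-- All blocks of `X` are finite. -/
class FiniteBlocks : Prop where
  finite : ∀ x : X, (block x).Finite

theorem finiteBlocks_of_encard_le {k : ℕ} (h : ∀ x : X, (block x).encard ≤ k) : FiniteBlocks X :=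
  ⟨fun x => Set.finite_of_encard_le_coe (h x)⟩

variable [FiniteBlocks X]

theorem exists_mem_lowerBounds_block (x : X) : ∃ a ∈ block x, a ∈ lowerBounds (block x) :=
  Set.exists_min_image _ id (FiniteBlocks.finite x) ⟨x, mem_block_self x⟩

/-- The first point of the block of `x`. -/
noncomputable def first (x : X) : BlockFirst X :=
  have hx := (exists_mem_lowerBounds_block x).choose_spec
  ⟨(exists_mem_lowerBounds_block x).choose, (block_eq_of_mem hx.1).symm ▸ hx.2⟩

theorem first_mem_block (x : X) : (first x).1 ∈ block x :=
  (exists_mem_lowerBounds_block x).choose_spec.1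

theorem first_le_of_mem_block {x y : X} (h : y ∈ block x) : (first x).1 ≤ y :=
  (first x).2 (mem_block_trans (mem_block_symm (first_mem_block x)) h)

theorem first_le (x : X) : (first x).1 ≤ x := first_le_of_mem_block (mem_block_self x)

theorem first_coe (a : BlockFirst X) : first a.1 = a :=
  Subtype.ext (le_antisymm (first_le a.1) (a.2 (first_mem_block a.1)))

theorem first_eq_iff {x y : X} : first x = first y ↔ y ∈ block x := by
  refine ⟨fun h => mem_block_trans (h ▸ first_mem_block x) (mem_block_symm (first_mem_block y)),
    fun h => Subtype.ext (le_antisymm ?_ ?_)⟩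
  · exact first_le_of_mem_block (mem_block_trans h (first_mem_block y))
  · exact first_le_of_mem_block (mem_block_trans (mem_block_symm h) (first_mem_block x))

theorem blockSize_eq_of_first_eq {x y : X} (h : first x = first y) : blockSize x = blockSize y := by
  rw [blockSize, blockSize, block_eq_of_mem (first_eq_iff.1 h)]

theorem sizeColor_first (x : X) : sizeColor X (first x) = blockSize x :=
  blockSize_eq_of_first_eq (first_coe _)

theorem blockSize_pos (x : X) : 0 < blockSize x :=
  (Set.ncard_pos (FiniteBlocks.finite x)).2 ⟨x, mem_block_self x⟩

theorem blockIndex_lt_blockSize (x : X) : blockIndex x < blockSize x :=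
  Set.ncard_lt_ncard ⟨Set.inter_subset_left, fun h => lt_irrefl x (h (mem_block_self x)).2⟩
    (FiniteBlocks.finite x)

theorem blockIndex_lt_of_lt {x y : X} (h : first x = first y) (hxy : x < y) :
    blockIndex x < blockIndex y := by
  rw [blockIndex, blockIndex, block_eq_of_mem (first_eq_iff.1 h)]
  exact Set.ncard_lt_ncard
    ⟨fun z hz => ⟨hz.1, hz.2.trans hxy⟩, fun hs => lt_irrefl x (hs ⟨mem_block_self x, hxy⟩).2⟩
    ((FiniteBlocks.finite x).inter_of_left _)

theorem blockIndex_lt_iff {x y : X} (h : first x = first y) :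
    blockIndex x < blockIndex y ↔ x < y := by
  refine ⟨fun hi => ?_, blockIndex_lt_of_lt h⟩
  rcases lt_trichotomy x y with hlt | rfl | hgt
  · exact hlt
  · exact (lt_irrefl _ hi).elim
  · exact (lt_asymm hi (blockIndex_lt_of_lt h.symm hgt)).elim

theorem eq_of_first_eq_of_blockIndex_eq {x y : X} (h : first x = first y)
    (hi : blockIndex x = blockIndex y) : x = y :=
  le_antisymm (not_lt.1 fun hgt => (blockIndex_lt_of_lt h.symm hgt).ne' hi)
    (not_lt.1 fun hlt => (blockIndex_lt_of_lt h hlt).ne hi)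

theorem first_mono {x y : X} (h : x ≤ y) : first x ≤ first y := by
  by_contra hn
  have hlt : (first y).1 < first x := not_le.1 hn
  exact hlt.ne (congrArg _ (first_eq_iff.2 ((ordConnected_block y).out (first_mem_block y)
    (mem_block_self y) ⟨hlt.le.trans (first_le x), h⟩)))

theorem lt_iff_first {x y : X} :
    x < y ↔ first x < first y ∨ first x = first y ∧ blockIndex x < blockIndex y := by
  constructor
  · intro h
    rcases (first_mono h.le).eq_or_lt with heq | hlt
    · exact Or.inr ⟨heq, blockIndex_lt_of_lt heq h⟩
    · exact Or.inl hlt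
  · rintro (hlt | ⟨heq, hi⟩)
    · exact not_le.1 fun hyx => hlt.not_ge (first_mono hyx)
    · exact (blockIndex_lt_iff heq).1 hi

theorem exists_blockIndex_eq {x : X} {i : ℕ} (hi : i < blockSize x) :
    ∃ y, first y = first x ∧ blockIndex y = i := by
  have hfirst : ∀ y ∈ block x, first y = first x := fun y hy => (first_eq_iff.2 hy).symm
  have hmaps : Set.MapsTo blockIndex (block x) (Finset.range (blockSize x)) := fun y hy =>
    Finset.mem_coe.2 (Finset.mem_range.2
      (blockSize_eq_of_first_eq (hfirst y hy) ▸ blockIndex_lt_blockSize y))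
  have hinj : (block x).InjOn blockIndex := fun y hy z hz =>
    eq_of_first_eq_of_blockIndex_eq ((hfirst y hy).trans (hfirst z hz).symm)
  have himage : blockIndex '' block x = Finset.range (blockSize x) :=
    Set.eq_of_subset_of_ncard_le hmaps.image_subset
      (by rw [Set.ncard_coe_finset, Finset.card_range, hinj.ncard_image, blockSize])
      (Finset.finite_toSet _)
  obtain ⟨y, hy, rfl⟩ : i ∈ blockIndex '' block x :=
    himage ▸ Finset.mem_coe.2 (Finset.mem_range.2 hi)
  exact ⟨y, hfirst y hy, rfl⟩

theorem covBy_iff_first {x y : X} :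
    x ⋖ y ↔ first x = first y ∧ blockIndex y = blockIndex x + 1 := by
  constructor
  · intro h
    have hf : first x = first y := first_eq_iff.2 (mem_block_of_covBy h)
    have hlt := blockIndex_lt_of_lt hf h.lt
    have hsize := blockSize_eq_of_first_eq hf ▸ blockIndex_lt_blockSize y
    refine ⟨hf, le_antisymm (not_lt.1 fun hgap => ?_) hlt⟩
    obtain ⟨z, hz, hzi⟩ := exists_blockIndex_eq (hgap.trans hsize)
    refine h.2 ((blockIndex_lt_iff hz.symm).1 ?_) ((blockIndex_lt_iff (hz.trans hf)).1 ?_) <;> omega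
  · rintro ⟨hf, hi⟩
    refine ⟨(blockIndex_lt_iff hf).1 (by omega), fun z hxz hzy => ?_⟩
    have hz : first x = first z := first_eq_iff.2 ((ordConnected_block x).out (mem_block_self x)
      (first_eq_iff.1 hf) ⟨hxz.le, hzy.le⟩)
    have hxz' := blockIndex_lt_of_lt hz hxz
    have hzy' := blockIndex_lt_of_lt (hz.symm.trans hf) hzy
    omega

instance denselyOrdered_blockFirst : DenselyOrdered (BlockFirst X) := by
  refine ⟨fun a b hab => ?_⟩
  by_contra! hn
  have hsub : Set.Icc a.1 b.1 ⊆ insert b.1 (block a.1) := by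
    intro z hz
    rcases hz.2.eq_or_lt with rfl | hzb
    · exact Set.mem_insert _ _
    have hle : a ≤ first z := first_coe a ▸ first_mono hz.1
    have heq : first a.1 = first z := (first_coe a).trans <| hle.eq_of_not_lt fun hlt =>
      (hn _ hlt).not_gt (show (first z).1 < b from (first_le z).trans_lt hzb)
    exact Set.mem_insert_of_mem _ (first_eq_iff.1 heq)
  have hb : b.1 ∈ block a.1 :=
    (mem_block_iff_of_le (show a.1 ≤ b.1 from hab.le)).2 <|
      ((FiniteBlocks.finite a.1).insert _).subset hsub
  exact not_lt.2 (b.2 (mem_block_symm hb)) hab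

end Blocks

section SuccPred

variable {X Y : Type} [LinearOrder X] [LinearOrder Y]

theorem succFn_eq_of_covBy {x y : X} (h : x ⋖ y) : succFn x = y := by
  have hex : ∃ y, x ⋖ y := ⟨y, h⟩
  rw [succFn, dif_pos hex]
  exact hex.choose_spec.unique_right h

theorem predFn_eq_of_covBy {x y : X} (h : x ⋖ y) : predFn y = x := by
  have hex : ∃ x, x ⋖ y := ⟨x, h⟩
  rw [predFn, dif_pos hex]
  exact hex.choose_spec.unique_left h

theorem succFn_cases (x : X) : x ⋖ succFn x ∨ (∀ y, ¬ x ⋖ y) ∧ succFn x = x := by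
  by_cases h : ∃ y, x ⋖ y
  · obtain ⟨y, hy⟩ := h
    exact Or.inl (by rwa [succFn_eq_of_covBy hy])
  · exact Or.inr ⟨fun y hy => h ⟨y, hy⟩, by rw [succFn, dif_neg h]⟩

theorem predFn_cases (x : X) : predFn x ⋖ x ∨ (∀ y, ¬ y ⋖ x) ∧ predFn x = x := by
  by_cases h : ∃ y, y ⋖ x
  · obtain ⟨y, hy⟩ := h
    exact Or.inl (by rwa [predFn_eq_of_covBy hy])
  · exact Or.inr ⟨fun y hy => h ⟨y, hy⟩, by rw [predFn, dif_neg h]⟩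

theorem apply_succFn (e : X ≃o Y) (x : X) : e (succFn x) = succFn (e x) := by
  rcases succFn_cases x with h | ⟨h, hx⟩
  · exact (succFn_eq_of_covBy ((apply_covBy_apply_iff e).2 h)).symm
  · rcases succFn_cases (e x) with hcov | ⟨-, hex⟩
    · refine (h (e.symm (succFn (e x))) ?_).elim
      rwa [← apply_covBy_apply_iff e, e.apply_symm_apply]
    · rw [hx, hex]

theorem apply_predFn (e : X ≃o Y) (x : X) : e (predFn x) = predFn (e x) := by
  rcases predFn_cases x with h | ⟨h, hx⟩
  · exact (predFn_eq_of_covBy ((apply_covBy_apply_iff e).2 h)).symm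
  · rcases predFn_cases (e x) with hcov | ⟨-, hex⟩
    · refine (h (e.symm (predFn (e x))) ?_).elim
      rwa [← apply_covBy_apply_iff e, e.apply_symm_apply]
    · rw [hx, hex]

variable [FiniteBlocks X]

theorem first_succFn (x : X) : first (succFn x) = first x := by
  rcases succFn_cases x with h | ⟨-, h⟩
  · exact (covBy_iff_first.1 h).1.symm
  · rw [h]

theorem first_predFn (x : X) : first (predFn x) = first x := by
  rcases predFn_cases x with h | ⟨-, h⟩
  · exact (covBy_iff_first.1 h).1
  · rw [h]

theorem blockIndex_succFn (x : X) : blockIndex (succFn x) =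
    if blockIndex x + 1 < blockSize x then blockIndex x + 1 else blockIndex x := by
  rcases succFn_cases x with h | ⟨h, hx⟩
  · obtain ⟨hf, hi⟩ := covBy_iff_first.1 h
    have hlt := blockIndex_lt_blockSize (succFn x)
    rw [← blockSize_eq_of_first_eq hf, hi] at hlt
    rw [if_pos hlt, hi]
  · rw [if_neg, hx]
    intro hlt
    obtain ⟨y, hy, hyi⟩ := exists_blockIndex_eq hlt
    exact h y (covBy_iff_first.2 ⟨hy.symm, hyi⟩)

theorem blockIndex_predFn (x : X) : blockIndex (predFn x) = blockIndex x - 1 := by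
  rcases predFn_cases x with h | ⟨h, hx⟩
  · have hi := (covBy_iff_first.1 h).2
    omega
  · rw [hx]
    by_contra hne
    obtain ⟨y, hy, hyi⟩ :=
      exists_blockIndex_eq ((Nat.sub_le _ 1).trans_lt (blockIndex_lt_blockSize x))
    exact h y (covBy_iff_first.2 ⟨hy, by omega⟩)

end SuccPred

section Transport

variable {X Y : Type} [LinearOrder X] [LinearOrder Y] [FiniteBlocks X] [FiniteBlocks Y]

/-- `e` embeds the set `A` of blocks of `X` into the blocks of `Y`, preserving their order and their
sizes. Its values off `A` are irrelevant. -/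
structure IsBlockEmbedding (A : Set (BlockFirst X)) (e : BlockFirst X → BlockFirst Y) : Prop where
  size : ∀ a ∈ A, sizeColor Y (e a) = sizeColor X a
  strictMonoOn : StrictMonoOn e A

open Classical in
/-- The point in the same position of the block `e (first x)` as `x` in its own block, if that block
is long enough, and the first point of `e (first x)` otherwise. -/
noncomputable def transport (e : BlockFirst X → BlockFirst Y) (x : X) : Y :=
  if h : ∃ y, first y = e (first x) ∧ blockIndex y = blockIndex x then h.choose else e (first x)

namespace IsBlockEmbedding

variable {A : Set (BlockFirst X)} {e : BlockFirst X → BlockFirst Y} {x y : X}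

theorem transport_spec (h : IsBlockEmbedding A e) (hx : first x ∈ A) :
    first (transport e x) = e (first x) ∧ blockIndex (transport e x) = blockIndex x := by
  have hex : ∃ y, first y = e (first x) ∧ blockIndex y = blockIndex x := by
    have hi := blockIndex_lt_blockSize x
    rw [← sizeColor_first, ← h.size _ hx] at hi
    obtain ⟨y, hy, hyi⟩ := exists_blockIndex_eq hi
    exact ⟨y, hy.trans (first_coe _), hyi⟩
  rw [transport, dif_pos hex]
  exact hex.choose_spec

theorem first_transport (h : IsBlockEmbedding A e) (hx : first x ∈ A) :
    first (transport e x) = e (first x) :=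
  (h.transport_spec hx).1

theorem blockIndex_transport (h : IsBlockEmbedding A e) (hx : first x ∈ A) :
    blockIndex (transport e x) = blockIndex x :=
  (h.transport_spec hx).2

theorem blockSize_transport (h : IsBlockEmbedding A e) (hx : first x ∈ A) :
    blockSize (transport e x) = blockSize x := by
  rw [← sizeColor_first, h.first_transport hx, h.size _ hx, sizeColor_first]

theorem transport_coe (h : IsBlockEmbedding A e) {a : BlockFirst X} (ha : a ∈ A) :
    transport e a.1 = e a := by
  have ha' : first a.1 ∈ A := (first_coe a).symm ▸ ha
  apply eq_of_first_eq_of_blockIndex_eq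
  · rw [h.first_transport ha', first_coe, first_coe]
  · rw [h.blockIndex_transport ha', blockIndex_coe, blockIndex_coe]

theorem strictMonoOn_transport (h : IsBlockEmbedding A e) :
    StrictMonoOn (transport e) {x | first x ∈ A} := by
  intro x hx y hy hxy
  rw [lt_iff_first, h.first_transport hx, h.first_transport hy, h.blockIndex_transport hx,
    h.blockIndex_transport hy]
  rcases lt_iff_first.1 hxy with hlt | ⟨heq, hi⟩
  · exact Or.inl (h.strictMonoOn hx hy hlt)
  · exact Or.inr ⟨congrArg e heq, hi⟩

theorem transport_succFn (h : IsBlockEmbedding A e) (hx : first x ∈ A) :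
    transport e (succFn x) = succFn (transport e x) := by
  have hs : first (succFn x) ∈ A := by rwa [first_succFn]
  apply eq_of_first_eq_of_blockIndex_eq
  · rw [h.first_transport hs, first_succFn, first_succFn, h.first_transport hx]
  · rw [h.blockIndex_transport hs, blockIndex_succFn, blockIndex_succFn,
      h.blockIndex_transport hx, h.blockSize_transport hx]

theorem transport_predFn (h : IsBlockEmbedding A e) (hx : first x ∈ A) :
    transport e (predFn x) = predFn (transport e x) := by
  have hp : first (predFn x) ∈ A := by rwa [first_predFn]
  apply eq_of_first_eq_of_blockIndex_eq
  · rw [h.first_transport hp, first_predFn, first_predFn, h.first_transport hx]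
  · rw [h.blockIndex_transport hp, blockIndex_predFn, blockIndex_predFn, h.blockIndex_transport hx]

end IsBlockEmbedding

theorem nonempty_orderIso_of_blockFirst (e : BlockFirst X ≃o BlockFirst Y)
    (he : ∀ a, sizeColor Y (e a) = sizeColor X a) : Nonempty (X ≃o Y) := by
  have h : IsBlockEmbedding Set.univ e := ⟨fun a _ => he a, e.strictMono.strictMonoOn _⟩
  have hmono : StrictMono (transport e) := fun x y hxy =>
    h.strictMonoOn_transport (Set.mem_univ _) (Set.mem_univ _) hxy
  refine ⟨hmono.orderIsoOfSurjective _ fun y => ?_⟩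
  have hi : blockIndex y < blockSize (e.symm (first y)).1 := by
    refine (blockIndex_lt_blockSize y).trans_eq ?_
    rw [← sizeColor_first, ← e.apply_symm_apply (first y), he, e.symm_apply_apply]
    rfl
  obtain ⟨x, hx, hxi⟩ := exists_blockIndex_eq hi
  rw [first_coe] at hx
  refine ⟨x, eq_of_first_eq_of_blockIndex_eq ?_ ?_⟩
  · rw [h.first_transport (Set.mem_univ _), hx, e.apply_symm_apply]
  · rw [h.blockIndex_transport (Set.mem_univ _), hxi]

end Transport

section SpHomogeneous

-- The low priority keeps the induced functions on a substructure, which is itself a linear order.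
noncomputable instance (priority := low) (X : Type) [LinearOrder X] : SpLang.Structure X :=
  SpStructure X

variable {X Y : Type} [LinearOrder X] [LinearOrder Y] [FiniteBlocks X] [FiniteBlocks Y]
  {A : Set (BlockFirst X)}

/-- The substructure of `(X, <, s, p)` consisting of the blocks in `A`. -/
def blocksOver (A : Set (BlockFirst X)) : SpLang.Substructure X where
  carrier := {x | first x ∈ A}
  fun_mem := fun f v hv => by
    cases f with
    | s => exact (congrArg (· ∈ A) (first_succFn (v 0))).mpr (hv 0)
    | p => exact (congrArg (· ∈ A) (first_predFn (v 0))).mpr (hv 0)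

theorem finite_blocksOver (hA : A.Finite) : (blocksOver A : Set X).Finite :=
  (hA.biUnion fun a _ => FiniteBlocks.finite a.1).subset fun x hx =>
    Set.mem_biUnion hx (mem_block_symm (first_mem_block x))

/-- A block embedding, extended to all points of the blocks on which it is defined. -/
noncomputable def IsBlockEmbedding.toEmbedding {e : BlockFirst X → BlockFirst Y}
    (h : IsBlockEmbedding A e) : blocksOver A ↪[SpLang] Y where
  toFun := fun x => transport e x
  inj' := fun x y hxy => Subtype.ext (h.strictMonoOn_transport.injOn x.2 y.2 hxy)
  map_fun' := fun f v => by
    cases f with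
    | s => exact h.transport_succFn (v 0).2
    | p => exact h.transport_predFn (v 0).2
  map_rel' := fun r v => by
    cases r with
    | lt => exact h.strictMonoOn_transport.lt_iff_lt (v 0).2 (v 1).2

theorem SpHomogeneous.exists_orderIso_of_isBlockEmbedding (hX : SpHomogeneous X) (hA : A.Finite)
    {e : BlockFirst X → BlockFirst X} (h : IsBlockEmbedding A e) :
    ∃ g : X ≃o X, ∀ a ∈ A, g a.1 = e a := by
  have hfg : (blocksOver A).FG :=
    Language.Substructure.fg_def.2 ⟨_, finite_blocksOver hA, Language.Substructure.closure_eq _⟩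
  obtain ⟨g, hg⟩ := hX _ hfg h.toEmbedding
  have hmono : StrictMono g := fun x y hxy =>
    (g.map_rel (LtRel.lt : SpLang.Relations 2) ![x, y]).2 hxy
  refine ⟨hmono.orderIsoOfSurjective g g.surjective, fun a ha => ?_⟩
  have hfirst : first a.1 ∈ A := (first_coe a).symm ▸ ha
  have hga := DFunLike.congr_fun hg ⟨a.1, hfirst⟩
  exact hga.symm.trans (h.transport_coe ha)

theorem SpHomogeneous.isSaturated (hX : SpHomogeneous X) : IsSaturated (sizeColor X) := by
  refine .of_forall_exists_strictMono fun F hF => ?_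
  have hval : ∀ a, ∃ b, ∀ p ∈ F, p.1 = a → p.2 = b := fun a => by
    by_cases h : ∃ p ∈ F, p.1 = a
    · obtain ⟨p, hp, rfl⟩ := h
      exact ⟨p.2, fun q hq => (hF.eq_iff hq hp).1⟩
    · exact ⟨a, fun p hp hpa => (h ⟨p, hp, hpa⟩).elim⟩
  choose e he using hval
  have he : ∀ p ∈ F, e p.1 = p.2 := fun p hp => (he _ p hp rfl).symm
  have hblock : IsBlockEmbedding (Prod.fst '' (F : Set (BlockFirst X × BlockFirst X))) e := by
    constructor
    · rintro - ⟨p, hp, rfl⟩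
      rw [he p hp]
      exact hF.1 p hp
    · rintro - ⟨p, hp, rfl⟩ - ⟨q, hq, rfl⟩ hlt
      rw [he p hp, he q hq]
      exact (hF.2 p hp q hq).1 hlt
  obtain ⟨g, hg⟩ :=
    hX.exists_orderIso_of_isBlockEmbedding (F.finite_toSet.image Prod.fst) hblock
  refine ⟨fun a => ⟨g a, apply_mem_lowerBounds_block g a⟩, fun a b hab => g.strictMono hab,
    fun a => blockSize_apply g a, fun p hp => Subtype.ext ?_⟩
  exact (hg _ ⟨p, hp, rfl⟩).trans (congrArg _ (he p hp))

theorem sizeColor_mem_Icc {k : ℕ} (h : ∀ x : X, (block x).encard ≤ k) (a : BlockFirst X) :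
    sizeColor X a ∈ Finset.Icc 1 k := by
  refine Finset.mem_Icc.2 ⟨blockSize_pos a.1, ?_⟩
  have ha := h a.1
  rw [← (FiniteBlocks.finite a.1).cast_ncard_eq] at ha
  exact_mod_cast ha

end SpHomogeneous

section Pattern

theorem IsSaturated.exists_denseArrangement {X κ : Type*} [LinearOrder X] [DenselyOrdered X]
    {cX : X → κ} (hX : IsSaturated cX) {U : Finset κ} (hU : ∀ x, cX x ∈ U) :
    ∃ V ∈ U.powerset, ∃ R ∈ denseArrangements V, colorPattern cX = (↑V, ↑R) := by
  have hrange : Set.range cX ⊆ U := Set.range_subset_iff.2 hU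
  obtain ⟨V, hV⟩ := (U.finite_toSet.subset hrange).exists_finset_coe
  have hbefore : {p : κ × κ | ColorBefore cX p.1 p.2} ⊆ (U ×ˢ U : Finset (κ × κ)) := by
    rintro ⟨-, -⟩ ⟨x, y, -, rfl, rfl⟩
    exact Finset.mem_coe.2 (Finset.mk_mem_product (hU x) (hU y))
  obtain ⟨R, hR⟩ := ((U ×ˢ U).finite_toSet.subset hbefore).exists_finset_coe
  have memV : ∀ {a}, a ∈ V ↔ ∃ x, cX x = a := fun {a} => Set.ext_iff.1 hV a
  have memR : ∀ {a b}, (a, b) ∈ R ↔ ColorBefore cX a b := fun {a b} => Set.ext_iff.1 hR (a, b)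
  refine ⟨V, Finset.mem_powerset.2 (Finset.coe_subset.1 (hV ▸ hrange)), R,
    mem_denseArrangements.2 ⟨⟨?_, ?_, ?_, ?_⟩, ?_⟩, by rw [hV, hR, colorPattern]⟩
  · intro a b hab
    obtain ⟨x, -, -, hx, -⟩ := memR.1 hab
    exact memV.2 ⟨x, hx⟩
  · intro a b hab
    obtain ⟨-, y, -, -, hy⟩ := memR.1 hab
    exact memV.2 ⟨y, hy⟩
  · intro a b c hab hbc
    obtain ⟨x, y, hxy, rfl, rfl⟩ := memR.1 hab
    obtain ⟨z, hyz, hz⟩ := hX.above y c (memR.1 hbc)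
    exact memR.2 ⟨x, z, hxy.trans hyz, rfl, hz⟩
  · intro a b ha hb hne
    obtain ⟨x, rfl⟩ := memV.1 ha
    obtain ⟨y, rfl⟩ := memV.1 hb
    rcases lt_or_gt_of_ne (ne_of_apply_ne cX hne) with hlt | hgt
    · exact Or.inl (memR.2 ⟨x, y, hlt, rfl, rfl⟩)
    · exact Or.inr (memR.2 ⟨y, x, hgt, rfl, rfl⟩)
  · intro a b hab
    obtain ⟨x, y, hxy, rfl, rfl⟩ := memR.1 hab
    obtain ⟨z, hxz, hzy⟩ := exists_between hxy
    exact ⟨cX z, memR.2 ⟨x, z, hxz, rfl, rfl⟩, memR.2 ⟨z, y, hzy, rfl, rfl⟩⟩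

end Pattern

section SpCounting

theorem spHomTypes_encard_le (k : ℕ) : (spHomTypes k).encard ≤
    (∑ V ∈ (Finset.Icc 1 k).powerset, (denseArrangements V).card : ℕ) := by
  let patterns := (Finset.Icc 1 k).powerset.sigma denseArrangements
  let toPattern : (Σ _ : Finset ℕ, Finset (ℕ × ℕ)) → Set ℕ × Set (ℕ × ℕ) := fun p => (↑p.1, ↑p.2)
  rw [← Finset.card_sigma, ← Set.encard_coe_eq_coe_finsetCard]
  refine (encard_image_le_of_invariant (V := toPattern '' patterns)
    (inv := fun X : LinOrd => colorPattern (sizeColor X)) ?_ ?_).trans (Set.encard_image_le _ _)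
  · rintro X ⟨-, hX, hk⟩
    have := finiteBlocks_of_encard_le hk
    obtain ⟨V, hV, R, hR, hVR⟩ := hX.isSaturated.exists_denseArrangement (sizeColor_mem_Icc hk)
    exact ⟨⟨V, R⟩, Finset.mem_coe.2 (Finset.mem_sigma.2 ⟨hV, hR⟩), hVR.symm⟩
  · rintro X ⟨_, hX, hXk⟩ Y ⟨_, hY, hYk⟩ h
    have := finiteBlocks_of_encard_le hXk
    have := finiteBlocks_of_encard_le hYk
    obtain ⟨e, he⟩ := hX.isSaturated.exists_orderIso hY.isSaturated h
    exact Quotient.sound (nonempty_orderIso_of_blockFirst e he)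

theorem spHomTypes_finite (k : ℕ) : (spHomTypes k).Finite :=
  Set.finite_of_encard_le_coe (spHomTypes_encard_le k)

theorem numSp_le_two_pow (k : ℕ) : (numSp k : ℝ) ≤ 5 / 2 * (k ! * 2 ^ k) := by
  have hsum := sum_card_denseArrangements_le (Finset.Icc 1 k)
  rw [Nat.card_Icc, Nat.add_sub_cancel] at hsum
  have hcard := (Set.encard_le_coe_iff_finite_ncard_le.1 (spHomTypes_encard_le k)).2
  refine le_trans ?_ hsum
  exact_mod_cast hcard

end SpCounting

section CHomogeneous

variable {X : Type} [LinearOrder X] {n m : ℕ}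

theorem mem_succs {x y : X} : y ∈ succs x ↔ x < y ∧ y ∈ block x := transGen_covBy_iff

theorem mem_preds {x y : X} : y ∈ preds x ↔ x ∈ succs y := Iff.rfl

theorem succs_subset_succs {x y : X} (h : y ∈ succs x) : succs y ⊆ succs x :=
  fun _ hz => Relation.TransGen.trans h hz

theorem preds_subset_preds {x y : X} (h : y ∈ succs x) : preds x ⊆ preds y :=
  fun _ hz => Relation.TransGen.trans hz h

theorem adj_comm {l : ℕ} {x y : X} : Adj l x y ↔ Adj l y x := by
  rw [Adj, Adj, ne_comm, min_comm, max_comm]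

theorem adj_of_lt {l : ℕ} {x y : X} (h : x < y) : Adj l x y ↔ (Set.Ioo x y).encard = l := by
  rw [Adj, min_eq_left h.le, max_eq_right h.le]
  exact and_iff_right h.ne

instance (n m : ℕ) : (CLang n m).IsRelational := fun _ => inferInstanceAs (IsEmpty Empty)

theorem CHomogeneous.exists_orderIso (hX : CHomogeneous n m X) {α : Type*} [Finite α] {u v : α → X}
    (hlt : ∀ a b, v a < v b ↔ u a < u b)
    (hsuccs : ∀ a, ∀ i < n, HasSuccs i (v a) ↔ HasSuccs i (u a))
    (hpreds : ∀ a, ∀ j < m, HasPreds j (v a) ↔ HasPreds j (u a))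
    (hadj : ∀ a b, u a < u b → ∀ l < n + m, Adj l (v a) (v b) ↔ Adj l (u a) (u b)) :
    ∃ g : X ≃o X, ∀ a, g (u a) = v a := by
  let _ : (CLang n m).Structure X := CStructure n m X
  have heq : ∀ a b, v a = v b ↔ u a = u b := fun a b => by
    simp only [le_antisymm_iff, ← not_lt, hlt]
  obtain ⟨ι, hι⟩ : ∃ ι : Set.range u → α, ∀ y, u (ι y) = y :=
    ⟨Set.rangeSplitting u, Set.apply_rangeSplitting u⟩
  obtain ⟨g, hg⟩ := exists_equiv_of_isUltrahomogeneous hX (Set.finite_range u) (v ∘ ι)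
    (fun y z hyz => Subtype.ext (by rw [← hι, ← hι, (heq _ _).1 hyz])) fun r w => by
      simp only [← hι]
      cases r with
      | lt => exact hlt _ _
      | S i => exact hsuccs _ i i.2
      | P j => exact hpreds _ j j.2
      | Adj l =>
        change Adj l (v (ι (w 0))) (v (ι (w 1))) ↔ Adj l (u (ι (w 0))) (u (ι (w 1)))
        rcases lt_trichotomy (u (ι (w 0))) (u (ι (w 1))) with h | h | h
        · exact hadj _ _ h l l.2
        · exact iff_of_false (fun h' => h'.1 ((heq _ _).2 h)) fun h' => h'.1 h
        · rw [adj_comm, hadj _ _ h l l.2, adj_comm]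
  have hmono : StrictMono g := fun x y hxy =>
    (g.map_rel (CRel.lt : (CLang n m).Relations 2) ![x, y]).2 hxy
  refine ⟨hmono.orderIsoOfSurjective g g.surjective, fun a => ?_⟩
  exact (hg ⟨u a, a, rfl⟩).trans ((heq _ _).2 (hι _))

/-- `x` has at least `n` successors and at least `m` predecessors, so that it satisfies none of the
unary predicates of `C_{n,m}`. -/
structure IsDeep (n m : ℕ) (x : X) : Prop where
  le_succs : n ≤ (succs x).encard
  le_preds : m ≤ (preds x).encard

theorem IsDeep.not_hasSuccs {x : X} (h : IsDeep n m x) {i : ℕ} (hi : i < n) : ¬ HasSuccs i x :=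
  fun hx => hi.not_ge (by exact_mod_cast hx ▸ h.le_succs)

theorem IsDeep.not_hasPreds {x : X} (h : IsDeep n m x) {j : ℕ} (hj : j < m) : ¬ HasPreds j x :=
  fun hx => hj.not_ge (by exact_mod_cast hx ▸ h.le_preds)

theorem not_adj_of_le_encard_Ioo {d l : ℕ} {x y : X} (hxy : x < y)
    (h : d ≤ (Set.Ioo x y).encard) (hl : l < d) : ¬ Adj l x y :=
  fun hadj => hl.not_ge (by exact_mod_cast (adj_of_lt hxy).1 hadj ▸ h)

theorem CHomogeneous.exists_orderIso_of_isDeep (hX : CHomogeneous n m X) {α : Type*} [Finite α]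
    {u v : α → X} (hlt : ∀ a b, v a < v b ↔ u a < u b) (hu : ∀ a, IsDeep n m (u a))
    (hv : ∀ a, IsDeep n m (v a))
    (hIoo : ∀ a b, u a < u b → (n + m : ℕ) ≤ (Set.Ioo (u a) (u b)).encard ∧
      (n + m : ℕ) ≤ (Set.Ioo (v a) (v b)).encard) :
    ∃ g : X ≃o X, ∀ a, g (u a) = v a :=
  hX.exists_orderIso hlt
    (fun a _ hi => iff_of_false ((hv a).not_hasSuccs hi) ((hu a).not_hasSuccs hi))
    (fun a _ hj => iff_of_false ((hv a).not_hasPreds hj) ((hu a).not_hasPreds hj))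
    fun a b hab _ hl => iff_of_false
      (not_adj_of_le_encard_Ioo ((hlt a b).2 hab) (hIoo a b hab).2 hl)
      (not_adj_of_le_encard_Ioo hab (hIoo a b hab).1 hl)

theorem encard_Ioo_of_covBy {x y z : X} (hxy : x < y) (hyz : y ⋖ z) :
    (Set.Ioo x z).encard = (Set.Ioo x y).encard + 1 := by
  rw [← Set.encard_insert_of_notMem Set.right_notMem_Ioo, Set.Ioo_insert_right hxy,
    ← Set.Ioi_inter_Iio, hyz.Iio_eq, Set.Ioi_inter_Iic]

section Chain

variable {a : ℕ → X} (ha : ∀ j, a j ⋖ a (j + 1))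

include ha

theorem encard_Ioo_of_forall_covBy (j : ℕ) : (Set.Ioo (a 0) (a (j + 1))).encard = j := by
  have hmono : StrictMono a := strictMono_nat_of_lt_succ fun j => (ha j).lt
  induction j with
  | zero => rw [(ha 0).Ioo_eq, Set.encard_empty, Nat.cast_zero]
  | succ j ih => rw [encard_Ioo_of_covBy (hmono j.succ_pos) (ha _), ih, Nat.cast_succ]

theorem mem_succs_of_forall_covBy {i j : ℕ} (hij : i < j) : a j ∈ succs (a i) :=
  (transGen_of_succ_of_lt (Function.onFun (· ⋖ ·) a) (fun k _ => ha k) hij).lift a fun _ _ => id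

theorem isDeep_of_forall_covBy (h : m ≤ (preds (a 0)).encard) (j : ℕ) : IsDeep n m (a j) := by
  have hmono : StrictMono a := strictMono_nat_of_lt_succ fun j => (ha j).lt
  constructor
  · have hinf : (succs (a j)).Infinite :=
      ((Set.Ioi_infinite j).image hmono.injective.injOn).mono
        (Set.image_subset_iff.2 fun k hk => mem_succs_of_forall_covBy ha hk)
    rw [hinf.encard_eq]
    exact le_top
  · rcases j.eq_zero_or_pos with rfl | hj
    · exact h
    · exact h.trans (Set.encard_le_encard
        (preds_subset_preds (mem_succs_of_forall_covBy ha hj)))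

end Chain

/-- The points `x ⋖ g x ⋖ g (g x) ⋖ ...` are all deep, so the language does not see how many points
lie between the first and a late one, and an automorphism changes this finite number. -/
theorem CHomogeneous.not_covBy_apply (hX : CHomogeneous n m X) (g : X ≃o X) {x : X}
    (hx : m ≤ (preds x).encard) : ¬ x ⋖ g x := by
  intro hg
  let a : ℕ → X := fun j => g^[j] x
  have ha : ∀ j, a j ⋖ a (j + 1) := fun j => by
    induction j with
    | zero => exact hg
    | succ j ih =>
      simp only [a, Function.iterate_succ_apply' g] at ih ⊢
      exact (apply_covBy_apply_iff g).2 ih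
  have hmono : StrictMono a := strictMono_nat_of_lt_succ fun j => (ha j).lt
  let d := n + m
  let u : Fin 2 → X := a ∘ ![0, d + 1]
  let v : Fin 2 → X := a ∘ ![0, d + 2]
  have hlt : ∀ i j, v i < v j ↔ u i < u j := by
    simp [Fin.forall_fin_two, u, v, hmono.lt_iff_lt]
  obtain ⟨h, hh⟩ := hX.exists_orderIso_of_isDeep hlt
    (fun i => isDeep_of_forall_covBy ha hx _) (fun i => isDeep_of_forall_covBy ha hx _) (by
      simp [Fin.forall_fin_two, u, v, hmono.lt_iff_lt, encard_Ioo_of_forall_covBy ha, d])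
  have himage : h '' Set.Ioo (a 0) (a (d + 1)) = Set.Ioo (a 0) (a (d + 2)) := by
    rw [h.image_Ioo]
    exact congrArg₂ Set.Ioo (hh 0) (hh 1)
  have hcard := congrArg Set.encard himage
  rw [h.injective.encard_image, encard_Ioo_of_forall_covBy ha,
    encard_Ioo_of_forall_covBy ha] at hcard
  exact d.lt_succ_self.ne (by exact_mod_cast hcard)

theorem exists_covBy_isDeep {x : X} (h : (n + m + 2 : ℕ) ≤ (block x).encard) :
    ∃ a c : X, a ⋖ c ∧ IsDeep n m a ∧ IsDeep n m c := by
  obtain ⟨s, hs, hcard⟩ := Set.exists_subset_encard_eq h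
  obtain ⟨F, rfl⟩ := (Set.finite_of_encard_eq_coe hcard).exists_finset_coe
  replace hcard : F.card = n + m + 2 := by
    exact_mod_cast (Set.encard_coe_eq_coe_finsetCard F).symm.trans hcard
  let f := F.orderEmbOfFin hcard
  have hf : ∀ i j, f j ∈ block (f i) := fun i j =>
    mem_block_trans (mem_block_symm (hs (F.orderEmbOfFin_mem hcard i)))
      (hs (F.orderEmbOfFin_mem hcard j))
  have hsuccs : ∀ {i j}, i < j → f j ∈ succs (f i) := fun hij =>
    mem_succs.2 ⟨f.strictMono hij, hf _ _⟩
  let s : Fin (n + m + 2) := ⟨m, by omega⟩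
  let t : Fin (n + m + 2) := ⟨m + 1, by omega⟩
  have hst : s < t := Nat.lt_succ_self m
  have hpreds : m ≤ (preds (f s)).encard := by
    refine le_trans ?_ (Set.encard_le_encard (s := f '' Set.Iio s)
      (Set.image_subset_iff.2 fun i hi => hsuccs hi))
    rw [f.injective.encard_image, ← Finset.coe_Iio, Set.encard_coe_eq_coe_finsetCard, Fin.card_Iio]
  have ht : n ≤ (succs (f t)).encard := by
    refine le_trans ?_ (Set.encard_le_encard (s := f '' Set.Ioi t)
      (Set.image_subset_iff.2 fun i hi => hsuccs hi))
    rw [f.injective.encard_image, ← Finset.coe_Ioi, Set.encard_coe_eq_coe_finsetCard, Fin.card_Ioi]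
    exact_mod_cast (by omega : n ≤ n + m + 2 - 1 - (m + 1))
  obtain ⟨c, hc, hct⟩ := exists_covBy_le (f.strictMono hst) (hf s t)
  have hcs : c ∈ succs (f s) := .single hc
  have hsub : succs (f t) ⊆ succs c := by
    rcases hct.eq_or_lt with rfl | hlt
    · exact subset_rfl
    · exact succs_subset_succs (mem_succs.2
        ⟨hlt, mem_block_trans (mem_block_symm (mem_block_of_covBy hc)) (hf s t)⟩)
  have hsc := ht.trans (Set.encard_le_encard hsub)
  exact ⟨f s, c, hc, ⟨hsc.trans (Set.encard_le_encard (succs_subset_succs hcs)), hpreds⟩, hsc,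
    hpreds.trans (Set.encard_le_encard (preds_subset_preds hcs))⟩

theorem CHomogeneous.encard_block_le (hX : CHomogeneous n m X) (x : X) :
    (block x).encard ≤ (n + m + 1 : ℕ) := by
  by_contra! hlt
  have hle : (n + m + 2 : ℕ) ≤ (block x).encard := by
    exact_mod_cast Order.add_one_le_of_lt hlt
  obtain ⟨a, c, hac, ha, hc⟩ := exists_covBy_isDeep hle
  obtain ⟨g, hg⟩ := hX.exists_orderIso_of_isDeep (u := fun _ : Unit => a) (v := fun _ => c)
    (by simp) (fun _ => ha) (fun _ => hc) (by simp)
  exact hX.not_covBy_apply g ha.le_preds (hg () ▸ hac)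

end CHomogeneous

section Embedding

variable {T X : Type} [SpLang.Structure T] [LinearOrder X]

/-- The relation `a ⋖ b`, expressed in the language of `(X, <, s, p)`
so that every embedding of `T` into a linear ordering carries it to `⋖`. -/
def SpCovBy (a b : T) : Prop :=
  Language.Structure.RelMap (L := SpLang) LtRel.lt ![a, b] ∧
    Language.Structure.funMap (L := SpLang) SpFunc.s ![a] = b

theorem covBy_iff_succFn_eq {x y : X} : x ⋖ y ↔ x < y ∧ succFn x = y := by
  refine ⟨fun h => ⟨h.lt, succFn_eq_of_covBy h⟩, ?_⟩
  rintro ⟨hlt, rfl⟩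
  exact (succFn_cases x).resolve_right fun h => hlt.ne' h.2

section

variable (f : T ↪[SpLang] X)

theorem embedding_lt_iff {a b : T} :
    f a < f b ↔ Language.Structure.RelMap (L := SpLang) LtRel.lt ![a, b] :=
  f.map_rel (LtRel.lt : SpLang.Relations 2) ![a, b]

theorem embedding_funMap_s (a : T) :
    f (Language.Structure.funMap (L := SpLang) SpFunc.s ![a]) = succFn (f a) :=
  f.map_fun (SpFunc.s : SpLang.Functions 1) ![a]

theorem embedding_funMap_p (a : T) :
    f (Language.Structure.funMap (L := SpLang) SpFunc.p ![a]) = predFn (f a) :=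
  f.map_fun (SpFunc.p : SpLang.Functions 1) ![a]

theorem embedding_covBy_iff {a b : T} : f a ⋖ f b ↔ SpCovBy a b := by
  rw [covBy_iff_succFn_eq, embedding_lt_iff, ← embedding_funMap_s, f.injective.eq_iff, SpCovBy]

theorem succs_embedding (a : T) : succs (f a) = f '' {b | Relation.TransGen SpCovBy a b} := by
  refine Set.Subset.antisymm (fun y hy => ?_) ?_
  · induction hy with
    | single h =>
      have hs := (embedding_funMap_s f a).trans (succFn_eq_of_covBy h)
      exact ⟨_, .single ((embedding_covBy_iff f).1 (hs.symm ▸ h)), hs⟩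
    | tail _ h ih =>
      obtain ⟨b, hb, rfl⟩ := ih
      have hs := (embedding_funMap_s f b).trans (succFn_eq_of_covBy h)
      exact ⟨_, .tail hb ((embedding_covBy_iff f).1 (hs.symm ▸ h)), hs⟩
  · rintro _ ⟨b, hb, rfl⟩
    exact hb.lift f fun _ _ => (embedding_covBy_iff f).2

theorem preds_embedding (a : T) : preds (f a) = f '' {b | Relation.TransGen SpCovBy b a} := by
  refine Set.Subset.antisymm (fun y hy => ?_) ?_
  · induction hy using Relation.TransGen.head_induction_on with
    | single h =>
      have hp := (embedding_funMap_p f a).trans (predFn_eq_of_covBy h)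
      exact ⟨_, .single ((embedding_covBy_iff f).1 (hp.symm ▸ h)), hp⟩
    | head h _ ih =>
      obtain ⟨b, hb, rfl⟩ := ih
      have hp := (embedding_funMap_p f b).trans (predFn_eq_of_covBy h)
      exact ⟨_, .head ((embedding_covBy_iff f).1 (hp.symm ▸ h)) hb, hp⟩
  · rintro _ ⟨b, hb, rfl⟩
    exact hb.lift f fun _ _ => (embedding_covBy_iff f).2

theorem embedding_mem_succs_iff {a b : T} :
    f b ∈ succs (f a) ↔ Relation.TransGen SpCovBy a b := by
  rw [succs_embedding, f.injective.mem_set_image, Set.mem_ofPred_eq]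

end

theorem Ioo_eq_of_mem_succs {x y : X} (h : y ∈ succs x) : Set.Ioo x y = succs x ∩ preds y := by
  refine Set.Subset.antisymm (fun z hz => ?_) fun z hz =>
    ⟨(mem_succs.1 hz.1).1, (mem_succs.1 (mem_preds.1 hz.2)).1⟩
  have hzx : z ∈ block x :=
    (ordConnected_block x).out (mem_block_self x) (mem_succs.1 h).2 ⟨hz.1.le, hz.2.le⟩
  exact ⟨mem_succs.2 ⟨hz.1, hzx⟩, mem_preds.2 (mem_succs.2
    ⟨hz.2, mem_block_trans (mem_block_symm hzx) (mem_succs.1 h).2⟩)⟩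

theorem encard_Ioo_of_notMem_succs {x y : X} (hxy : x < y) (h : y ∉ succs x) :
    (Set.Ioo x y).encard = ⊤ := by
  rw [Set.encard_eq_top_iff]
  refine fun hfin => h (mem_succs.2 ⟨hxy, (mem_block_iff_of_le hxy.le).2 ?_⟩)
  rw [← Set.Ioo_union_both hxy.le]
  exact hfin.union (Set.toFinite _)

theorem encard_succs_embedding (f g : T ↪[SpLang] X) (a : T) :
    (succs (f a)).encard = (succs (g a)).encard := by
  rw [succs_embedding, succs_embedding, f.injective.encard_image, g.injective.encard_image]

theorem encard_preds_embedding (f g : T ↪[SpLang] X) (a : T) :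
    (preds (f a)).encard = (preds (g a)).encard := by
  rw [preds_embedding, preds_embedding, f.injective.encard_image, g.injective.encard_image]

theorem encard_Ioo_embedding (f g : T ↪[SpLang] X) {a b : T} (h : f a < f b) :
    (Set.Ioo (f a) (f b)).encard = (Set.Ioo (g a) (g b)).encard := by
  by_cases hab : Relation.TransGen SpCovBy a b
  · rw [Ioo_eq_of_mem_succs ((embedding_mem_succs_iff f).2 hab),
      Ioo_eq_of_mem_succs ((embedding_mem_succs_iff g).2 hab), succs_embedding, succs_embedding,
      preds_embedding, preds_embedding, ← Set.image_inter f.injective,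
      ← Set.image_inter g.injective, f.injective.encard_image, g.injective.encard_image]
  · have hg : g a < g b := (embedding_lt_iff g).2 ((embedding_lt_iff f).1 h)
    rw [encard_Ioo_of_notMem_succs h (mt (embedding_mem_succs_iff f).1 hab),
      encard_Ioo_of_notMem_succs hg (mt (embedding_mem_succs_iff g).1 hab)]

theorem finite_of_fg [FiniteBlocks X] {S : SpLang.Substructure X} (hS : S.FG) : Finite S := by
  obtain ⟨t, rfl⟩ := hS
  have hle : Language.Substructure.closure SpLang (t : Set X) ≤
      blocksOver (first '' (t : Set X)) :=
    Language.Substructure.closure_le.2 fun x hx => ⟨x, hx, rfl⟩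
  exact ((finite_blocksOver (t.finite_toSet.image first)).subset hle).to_subtype

/-- An automorphism of a linear ordering preserves the definable functions `s` and `p`. -/
def spEquivOfOrderIso (g : X ≃o X) : X ≃[SpLang] X where
  toEquiv := g.toEquiv
  map_fun' := fun c v => by
    cases c with
    | s => exact apply_succFn g (v 0)
    | p => exact apply_predFn g (v 0)
  map_rel' := fun r v => by
    cases r with
    | lt => exact g.lt_iff_lt

theorem CHomogeneous.spHomogeneous {n m : ℕ} (hX : CHomogeneous n m X) : SpHomogeneous X := by
  have : FiniteBlocks X := finiteBlocks_of_encard_le hX.encard_block_le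
  intro S hS f
  have : Finite S := finite_of_fg hS
  let ι : S ↪[SpLang] X := S.subtype
  have hlt : ∀ a b, f a < f b ↔ ι a < ι b := fun a b =>
    (embedding_lt_iff f).trans (embedding_lt_iff ι).symm
  obtain ⟨g, hg⟩ := hX.exists_orderIso hlt
    (fun a i _ => by rw [HasSuccs, HasSuccs, encard_succs_embedding f ι])
    (fun a j _ => by rw [HasPreds, HasPreds, encard_preds_embedding f ι])
    (fun a b hab l _ => by
      rw [adj_of_lt hab, adj_of_lt ((hlt a b).2 hab), encard_Ioo_embedding ι f hab])
  exact ⟨spEquivOfOrderIso g, Language.Embedding.ext fun a => (hg a).symm⟩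

end Embedding

section Asymptotics

theorem cHomTypes_subset_spHomTypes (n m : ℕ) : cHomTypes n m ⊆ spHomTypes (n + m + 1) := by
  rintro _ ⟨X, ⟨hcount, hX⟩, rfl⟩
  exact ⟨X, ⟨hcount, hX.spHomogeneous, hX.encard_block_le⟩, rfl⟩

theorem cHomTypes_finite (n m : ℕ) : (cHomTypes n m).Finite :=
  (spHomTypes_finite _).subset (cHomTypes_subset_spHomTypes n m)

theorem numC_le_numSp (n m : ℕ) : numC n m ≤ numSp (n + m + 1) :=
  Set.ncard_le_ncard (cHomTypes_subset_spHomTypes n m) (spHomTypes_finite _)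

theorem numSp_le (k : ℕ) : (numSp k : ℝ) ≤ 5 / 2 * (k ! * 2.123 ^ k) := by
  refine (numSp_le_two_pow k).trans ?_
  gcongr
  norm_num

theorem numC_le (n m : ℕ) :
    (numC n m : ℝ) ≤ 5 / 2 * ((n + m + 1)! * 2.123 ^ (n + m + 1)) :=
  (Nat.cast_le.2 (numC_le_numSp n m)).trans (numSp_le _)

theorem numSp_isBigO :
    (fun k : ℕ => (numSp k : ℝ)) =O[atTop] fun k : ℕ => (k ! : ℝ) * 2.123 ^ k := by
  refine Asymptotics.IsBigO.of_bound (5 / 2) (Eventually.of_forall fun k => ?_)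
  rw [Real.norm_of_nonneg (by positivity), Real.norm_of_nonneg (by positivity)]
  exact numSp_le k

theorem numSp_div_numColored_le (k : ℕ) :
    (numSp k : ℝ) / numColored k ≤ 11 / 4 * (10 / 11) ^ k := by
  have hcolored := le_numColored k
  have hpos : 0 < (k ! : ℝ) * (11 / 5) ^ k := by positivity
  have hpow : (2 : ℝ) ^ k = (10 / 11) ^ k * (11 / 5) ^ k := by
    rw [← mul_pow]
    norm_num
  rw [div_le_iff₀ (by linarith)]
  calc (numSp k : ℝ) ≤ 5 / 2 * (k ! * 2 ^ k) := numSp_le_two_pow k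
    _ = 11 / 4 * (10 / 11) ^ k * (10 / 11 * (k ! * (11 / 5) ^ k)) := by
      rw [hpow]
      ring
    _ ≤ 11 / 4 * (10 / 11) ^ k * numColored k := by gcongr

theorem tendsto_numSp_div_numColored :
    Tendsto (fun k : ℕ => (numSp k : ℝ) / numColored k) atTop (𝓝 0) := by
  refine squeeze_zero (fun k => by positivity) numSp_div_numColored_le ?_
  have hpow : Tendsto (fun k : ℕ => (10 / 11 : ℝ) ^ k) atTop (𝓝 0) :=
    tendsto_pow_atTop_nhds_zero_of_lt_one (by norm_num) (by norm_num)
  simpa only [mul_zero] using hpow.const_mul (11 / 4)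

theorem exists_numC_div_numColored_lt {ε : ℝ} (hε : 0 < ε) : ∃ K : ℕ, ∀ n m : ℕ,
    K ≤ n + m + 1 → (numC n m : ℝ) / numColored (n + m + 1) < ε := by
  obtain ⟨K, hK⟩ :=
    eventually_atTop.1 (tendsto_numSp_div_numColored.eventually (gt_mem_nhds hε))
  refine ⟨K, fun n m hle => lt_of_le_of_lt ?_ (hK _ hle)⟩
  have := numC_le_numSp n m
  gcongr

end Asymptotics

end LinHom

theorem mainTheorem8 :
    ((∀ n m : ℕ, (LinHom.cHomTypes n m).Finite) ∧
      (∀ k : ℕ, (LinHom.spHomTypes k).Finite) ∧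
      (∀ k : ℕ, (LinHom.colorHomTypes k).Finite)) ∧
    (∃ C : ℝ, ∀ n m k : ℕ, k = n + m + 1 →
      (LinHom.numC n m : ℝ) ≤ C * ((k ! : ℝ) * (2.123 : ℝ) ^ k)) ∧
    (∀ ε : ℝ, 0 < ε → ∃ K : ℕ, ∀ n m k : ℕ, k = n + m + 1 → K ≤ k →
      (LinHom.numC n m : ℝ) / (LinHom.numColored k : ℝ) < ε) ∧
    ((fun k : ℕ => (LinHom.numSp k : ℝ)) =O[atTop]
      (fun k : ℕ => (k ! : ℝ) * (2.123 : ℝ) ^ k)) ∧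
    Tendsto (fun k : ℕ => (LinHom.numSp k : ℝ) / (LinHom.numColored k : ℝ)) atTop (𝓝 0) := by
  refine ⟨⟨LinHom.cHomTypes_finite, LinHom.spHomTypes_finite, LinHom.colorHomTypes_finite⟩,
    ⟨5 / 2, ?_⟩, fun ε hε => ?_, LinHom.numSp_isBigO, LinHom.tendsto_numSp_div_numColored⟩
  · rintro n m _ rfl
    exact LinHom.numC_le n m
  · obtain ⟨K, hK⟩ := LinHom.exists_numC_div_numColored_lt hε
    refine ⟨K, ?_⟩
    rintro n m _ rfl
    exact hK n m
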